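/- Let $\Gamma\le \mathrm{PSL}_2(\mathbb R)$ be a discrete cofinite subgroup, $\mu=\frac{dx\,dy}{y^2}$ the hyperbolic measure on $\mathbb H$, and let $\mathcal F\subset\mathbb H$ be a fundamental polygon for $\Gamma$: an open convex hyperbolic polygon with finitely many sides such that the $\Gamma$-translates of $\overline{\mathcal F}$ cover $\mathbb H$, and any two $\Gamma$-equivalent points of $\overline{\mathcal F}$ are equal or both lie on $\partial\mathcal F$. *Closed geodesics.* Let $a_t=\mathrm{diag}(e^{t/2},e^{-t/2})$. An oriented closed geodesic $\mathcal C$ is a periodic orbit $\{\Gamma g a_t:t\in\mathbb R\}$ in $\Gamma\backslash\mathrm{PSL}_2(\mathbb R)$; its length $|\mathcal C|$ is the least $T>0$ with $ga_Tg^{-1}\in\Gamma$, and $\mu_{\mathcal C}(\Psi)=\int_0^{|\mathcal C|}\Psi(\Gamma ga_t)\,dt$. A sequence $\mathbf C_1,\mathbf C_2,\dots$ of finite collections of oriented closed geodesics equidistributes in the unit tangent bundle if for every smooth compactly supported $\Psi:\Gamma\backslash\mathrm{PSL}_2(\mathbb R)\to\mathbb C$ $$\frac{\sum_{\mathcal C\in\mathbf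 C_n}\mu_{\mathcal C}(\Psi)}{\sum_{\mathcal C\in\mathbf C_n}|\mathcal C|}\longrightarrow\frac{1}{\mathrm{vol}(\Gamma)}\int_{\Gamma\backslash\mathrm{PSL}_2(\mathbb R)}\Psi\,d\mu_G\qquad(n\to\infty),$$ where $\mu_G$ is the Haar measure on $\mathrm{PSL}_2(\mathbb R)$ whose push-forward under $g\mapsto g\cdot i$ is $\mu$, and $\mathrm{vol}(\Gamma)=\mu(\mathcal F)$. *Partial coverings.* Let $\tilde S=\{g a_t i:t\in\mathbb R\}$ be the complete oriented geodesic in $\mathbb H$ lifting $\mathcal C$, and let $\tilde B$ be the closed half-plane to the left of $\tilde S$. Let $\gamma_1,\dots,\gamma_m\in\Gamma$ be the elements for which $\gamma_i\mathcal F$ is crossed by $\tilde S$ and entered during one period, i.e. at a time $t\in[0,|\mathcal C|)$, so that each crossing of a tile by $\mathcal C$ is counted once. The partial covering $\mathcal P(\mathcal C,\mathcal F)$ is the function on $\Gamma\backslash\mathbb H$ given by $$\mathcal P(\mathcal C,\mathcal F)(x)=\sum_{i=1}^m\#\{w\in\tilde B\cap\gamma_i\mathcal F:\Gamma w=x\},$$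 and $\mathcal P(\mathbf C,\mathcal F)=\sum_{\mathcal C\in\mathbf C}\mathcal P(\mathcal C,\mathcal F)$. For measurable $\mathcal B\subset\mathcal F$ put $\mathrm{vol}(\mathcal P(\mathbf C,\mathcal F)\cap\mathcal B)=\int_{\mathcal B}\mathcal P(\mathbf C,\mathcal F)(\Gamma z)\,d\mu(z)$, and $\mathrm{vol}(\mathcal P(\mathbf C,\mathcal F))=\mathrm{vol}(\mathcal P(\mathbf C,\mathcal F)\cap\mathcal F)$. *Cuspidal zones.* Let $\mathbf C(\mathcal F)$ be the set of cuspidal vertices of $\mathcal F$, i.e. the points of $\mathbf P^1(\mathbb R)$ that are fixed by a parabolic element of $\Gamma$ and lie in the closure of $\mathcal F$ in $\mathbf P^1(\mathbb C)$. For $\mathfrak a\in\mathbf C(\mathcal F)$ let $\sigma_{\mathfrak a}\in\mathrm{PSL}_2(\mathbb R)$ be a scaling matrix, i.e. $\sigma_{\mathfrak a}\infty=\mathfrak a$ and $\sigma_{\mathfrak a}^{-1}\Gamma_{\mathfrak a}\sigma_{\mathfrak a}=\{\begin{pmatrix}1&k\\0&1\end{pmatrix}:k\in\mathbb Z\}$,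 where $\Gamma_{\mathfrak a}$ is the stabilizer of $\mathfrak a$ in $\Gamma$, and for $Y>0$ put $$\mathcal F_{\mathfrak a}(Y)=\{z\in\mathcal F:\ \mathrm{Im}(\sigma_{\mathfrak a}^{-1}z)\ge Y\},$$ which does not depend on the choice of $\sigma_{\mathfrak a}$. **Proposition 4.6 (non-escape of mass).** There is a constant $K>0$, depending only on $\Gamma$ and $\mathcal F$, such that the following holds. Let $\mathbf C_1,\mathbf C_2,\dots$ be a sequence of finite collections of oriented closed geodesics that equidistributes in the unit tangent bundle $\Gamma\backslash\mathrm{PSL}_2(\mathbb R)$, and let $\mathfrak a\in\mathbf C(\mathcal F)$. Then there exists $Y_0>0$ such that for every $Y\ge Y_0$ there exists $n_0(Y)\ge1$ with $$\mathrm{vol}\big(\mathcal P(\mathbf C_n,\mathcal F)\cap\mathcal F_{\mathfrak a}(Y)\big)\le K\,\mathrm{vol}\big(\mathcal P(\mathbf C_n,\mathcal F)\big)\,Y^{-1/2}\qquad\text{for all }n\ge n_0(Y).$$ -/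

import Mathlib

open scoped MatrixGroups Pointwise ENNReal Topology UpperHalfPlane
open MeasureTheory Filter

noncomputable section

namespace HypSurface

/-! ### The group `PSL(2, ℝ)` and its actions on `ℍ` and on `P¹(ℝ) = ℝ ∪ {∞}` -/

/-- The action of `PSL(2, ℝ)` on the upper half-plane by linear fractional transformations. -/
instance pslAction : MulAction PSL(2, ℝ) ℍ :=
  MulAction.compHom ℍ (Matrix.ProjectiveSpecialLinearGroup.toPGL (n := Fin 2) (R := ℝ))

/-- The action of `SL(2, ℝ)` on `P¹(ℝ)` by linear fractional transformations. -/
def slBoundaryPerm : SL(2, ℝ) →* Equiv.Perm (OnePoint ℝ) :=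
  (MulAction.toPermHom (GL (Fin 2) ℝ) (OnePoint ℝ)).comp Matrix.SpecialLinearGroup.toGL

theorem center_le_ker_slBoundaryPerm :
    Subgroup.center SL(2, ℝ) ≤ slBoundaryPerm.ker := by
  intro g hg
  obtain ⟨r, hr, hrg⟩ := Matrix.SpecialLinearGroup.mem_center_iff.mp hg
  have hr0 : r ≠ 0 := by
    rintro rfl
    simp at hr
  have h00 : g.1 0 0 = r := by rw [← hrg]; simp
  have h01 : g.1 0 1 = 0 := by rw [← hrg]; simp
  have h10 : g.1 1 0 = 0 := by rw [← hrg]; simp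
  have h11 : g.1 1 1 = r := by rw [← hrg]; simp
  rw [MonoidHom.mem_ker]
  ext x
  change Matrix.SpecialLinearGroup.toGL g • x = x
  cases x with
  | infty => simp [OnePoint.smul_infty_eq_ite, h10]
  | coe k => simp [OnePoint.smul_some_eq_ite, h00, h01, h10, h11, hr0]

/-- The action of `PSL(2, ℝ)` on `P¹(ℝ)` by linear fractional transformations. -/
instance pslBoundaryAction : MulAction PSL(2, ℝ) (OnePoint ℝ) :=
  MulAction.compHom (OnePoint ℝ)
    (QuotientGroup.lift (Subgroup.center SL(2, ℝ)) slBoundaryPerm center_le_ker_slBoundaryPerm)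

/-- The projection `SL(2, ℝ) → PSL(2, ℝ)`. -/
def toPSL : SL(2, ℝ) →* PSL(2, ℝ) := QuotientGroup.mk' (Subgroup.center SL(2, ℝ))

/-- The matrix `diag(e^{t/2}, e^{-t/2})`. -/
def diagMat (t : ℝ) : SL(2, ℝ) :=
  ⟨!![Real.exp (t / 2), 0; 0, Real.exp (-(t / 2))], by simp [← Real.exp_add]⟩

/-- The upper triangular unipotent matrix with upper right entry `x`. -/
def unipMat (x : ℝ) : SL(2, ℝ) := ⟨!![1, x; 0, 1], by simp⟩

/-- The rotation with rows `(cos θ, sin θ)` and `(-sin θ, cos θ)`. -/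
def rotMat (θ : ℝ) : SL(2, ℝ) :=
  ⟨!![Real.cos θ, Real.sin θ; -Real.sin θ, Real.cos θ], by simp [← sq]⟩

/-- The element `a_t` of the diagonal subgroup `A` of `PSL(2, ℝ)`. -/
def diagElt (t : ℝ) : PSL(2, ℝ) := toPSL (diagMat t)

/-- The unipotent element `n_x` of `PSL(2, ℝ)`, acting by `z ↦ z + x`. -/
def unipElt (x : ℝ) : PSL(2, ℝ) := toPSL (unipMat x)

/-- The rotation `k_θ` in `PSL(2, ℝ)`; the group `PSO(2)` is parametrized once by `θ ∈ [0, π)`. -/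
def rotElt (θ : ℝ) : PSL(2, ℝ) := toPSL (rotMat θ)

/-! ### Cofinite discrete groups, fundamental polygons and cusps -/

/-- A (discrete) group `Γ` is cofinite if `Γ \ ℍ` has finite hyperbolic volume, that is, if the
`Γ`-translates of some measurable set of finite hyperbolic area cover `ℍ`.
Here and below, `volume` on `ℍ` is the hyperbolic measure `dx dy / y²`. -/
def IsCofinite (Γ : Subgroup PSL(2, ℝ)) : Prop :=
  ∃ D : Set ℍ, MeasurableSet D ∧ volume D < ⊤ ∧ ∀ z : ℍ, ∃ γ ∈ Γ, γ • z ∈ D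

/-- The open half-plane to the left of the oriented geodesic `g(0) → g(∞)`. -/
def openHalfPlane (g : PSL(2, ℝ)) : Set ℍ := {z | (g⁻¹ • z).re < 0}

/-- `F` is a fundamental polygon for `Γ`: it is an (open) finite-sided convex hyperbolic polygon,
i.e. a finite intersection of open half-planes, every point of `ℍ` is `Γ`-equivalent to a point of
the closure of `F`, and two `Γ`-equivalent points of the closure are equal or both lie on the
boundary. -/
structure IsFundamentalPolygon (Γ : Subgroup PSL(2, ℝ)) (F : Set ℍ) : Prop where
  polygon : ∃ S : Finset PSL(2, ℝ), F = ⋂ g ∈ S, openHalfPlane g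
  covers : ∀ z : ℍ, ∃ γ ∈ Γ, γ • z ∈ closure F
  equiv_boundary : ∀ z₁ ∈ closure F, ∀ z₂ ∈ closure F, (∃ γ ∈ Γ, γ • z₁ = z₂) →
    z₁ = z₂ ∨ (z₁ ∈ frontier F ∧ z₂ ∈ frontier F)

/-- The preimage of `Γ` in `SL(2, ℝ)`, viewed in `GL(2, ℝ)`. -/
def glPreimage (Γ : Subgroup PSL(2, ℝ)) : Subgroup (GL (Fin 2) ℝ) :=
  (Γ.comap toPSL).map Matrix.SpecialLinearGroup.toGL

/-- The cuspidal vertices of `F`: the cusps of `Γ` (fixed points in `P¹(ℝ)` of parabolic elements)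
lying in the closure of `F` in the Riemann sphere `ℂ ∪ {∞}`. -/
def cuspidalVertices (Γ : Subgroup PSL(2, ℝ)) (F : Set ℍ) : Set (OnePoint ℝ) :=
  {a | IsCusp a (glPreimage Γ) ∧
    OnePoint.map Complex.ofReal a ∈ closure ((fun z : ℍ ↦ ((z : ℂ) : OnePoint ℂ)) '' F)}

/-- `σ ∈ PSL(2, ℝ)` is a scaling matrix for `a`: it maps `∞` to `a`, and conjugation by `σ⁻¹` maps
the stabilizer of `a` in `Γ` onto the group of integral translations. -/
def IsScaling (Γ : Subgroup PSL(2, ℝ)) (a : OnePoint ℝ) (σ : PSL(2, ℝ)) : Prop :=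
  σ • (OnePoint.infty : OnePoint ℝ) = a ∧
    (fun γ ↦ σ⁻¹ * γ * σ) '' {γ | γ ∈ Γ ∧ γ • a = a} = Set.range fun k : ℤ ↦ unipElt k

/-- The cuspidal zone of `F` of height `Y`, at the cusp with scaling matrix `σ`. -/
def cuspidalZone (F : Set ℍ) (σ : PSL(2, ℝ)) (Y : ℝ) : Set ℍ :=
  {z ∈ F | Y ≤ (σ⁻¹ • z).im}

/-! ### Oriented closed geodesics -/

/-- An oriented closed geodesic on `Γ \ ℍ`, i.e. a periodic orbit `Γ g A` of the geodesic flow on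
`Γ \ PSL(2, ℝ)`; `carrier` is the preimage of this orbit in `PSL(2, ℝ)`. -/
structure ClosedGeodesic (Γ : Subgroup PSL(2, ℝ)) where
  carrier : Set PSL(2, ℝ)
  exists_lift : ∃ g : PSL(2, ℝ), (∃ T : ℝ, 0 < T ∧ g * diagElt T * g⁻¹ ∈ Γ) ∧
    carrier = {h | ∃ γ ∈ Γ, ∃ t : ℝ, h = γ * g * diagElt t}

namespace ClosedGeodesic

variable {Γ : Subgroup PSL(2, ℝ)} (c : ClosedGeodesic Γ)

/-- A lift `g` of a point of the periodic orbit to `PSL(2, ℝ)`. The curve `t ↦ g a_t i` is then a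
unit speed lift of the closed geodesic to `ℍ`, running from `g(0)` to `g(∞)`. The notions below
do not depend on the choice of the lift. -/
def lift : PSL(2, ℝ) := c.exists_lift.choose

/-- The lifted geodesic in `ℍ`, parametrized by arc length. -/
def path (t : ℝ) : ℍ := (c.lift * diagElt t) • UpperHalfPlane.I

/-- The length of the closed geodesic: the least positive period of the geodesic flow. -/
def length : ℝ := sInf {T : ℝ | 0 < T ∧ c.lift * diagElt T * c.lift⁻¹ ∈ Γ}

/-- The integral of `Ψ` against the flow-invariant measure on the closed geodesic of total mass
equal to its length. -/
def integral (Ψ : PSL(2, ℝ) → ℂ) : ℂ := ∫ t in (0 : ℝ)..c.length, Ψ (c.lift * diagElt t)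

/-- The closed half-plane to the left of the lifted geodesic. -/
def leftSide : Set ℍ := {z | (c.lift⁻¹ • z).re ≤ 0}

/-- The elements `γ ∈ Γ` such that the lifted geodesic crosses the (open) tile `γ F`, each crossing
of the closed geodesic being listed once: the tile is entered at a time in `[0, length)`. -/
def crossed (F : Set ℍ) : Set PSL(2, ℝ) :=
  {γ | γ ∈ Γ ∧ ∃ t : ℝ, IsGLB {s | c.path s ∈ γ • F} t ∧ 0 ≤ t ∧ t < c.length}

end ClosedGeodesic

/-- The total length of a collection of closed geodesics. -/
def totalLength {Γ : Subgroup PSL(2, ℝ)} (C : Multiset (ClosedGeodesic Γ)) : ℝ :=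
  (C.map fun c ↦ c.length).sum

/-! ### Equidistribution in the unit tangent bundle -/

/-- Smoothness of a function on `PSL(2, ℝ)`, tested in the Iwasawa coordinates
`(x, s, θ) ↦ n_x a_s k_θ`, which are a local diffeomorphism from `ℝ³` onto `PSL(2, ℝ)`. -/
def IsSmooth (Ψ : PSL(2, ℝ) → ℂ) : Prop :=
  ContDiff ℝ ((⊤ : ℕ∞) : WithTop ℕ∞) fun p : ℝ × ℝ × ℝ ↦ Ψ (unipElt p.1 * diagElt p.2.1 * rotElt p.2.2)

/-- The integral over `Γ \ PSL(2, ℝ)` of a left `Γ`-invariant function, for a fundamental domain `F`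
of `Γ` in `ℍ` and the Haar measure that pushes forward to `dx dy / y²` on `ℍ`. In the Iwasawa
coordinates `z = x + iy`, `g = n_x a_{log y} k_θ`, `0 ≤ θ < π`, this Haar measure is
`(dx dy / y²) (dθ / π)`. -/
def unitTangentIntegral (F : Set ℍ) (Ψ : PSL(2, ℝ) → ℂ) : ℂ :=
  ∫ z in F, (((Real.pi⁻¹ : ℝ) : ℂ) * ∫ θ in (0 : ℝ)..Real.pi,
    Ψ (unipElt z.re * diagElt (Real.log z.im) * rotElt θ))

/-- The sequence `C` of finite collections of oriented closed geodesics (repetitions are allowed)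
equidistributes in the unit tangent bundle `Γ \ PSL(2, ℝ)`: the averages of each smooth compactly
supported function on `Γ \ PSL(2, ℝ)` converge to its mean value. -/
def Equidistributes (Γ : Subgroup PSL(2, ℝ)) (F : Set ℍ)
    (C : ℕ → Multiset (ClosedGeodesic Γ)) : Prop :=
  ∀ Ψ : PSL(2, ℝ) → ℂ, (∀ γ ∈ Γ, ∀ g, Ψ (γ * g) = Ψ g) → IsSmooth Ψ →
    (∃ K : Set PSL(2, ℝ), IsCompact K ∧ ∀ g, Ψ g ≠ 0 → ∃ γ ∈ Γ, γ * g ∈ K) →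
    Tendsto (fun n ↦ ((C n).map fun c ↦ c.integral Ψ).sum / (totalLength (C n) : ℂ)) atTop
      (𝓝 (unitTangentIntegral F Ψ / (volume.real F : ℂ)))

/-! ### Partial coverings -/

/-- The function on `Γ \ ℍ`, viewed as a `Γ`-invariant function on `ℍ`, that counts the points of
`B` above a given point of `Γ \ ℍ`. -/
def coverCount (Γ : Subgroup PSL(2, ℝ)) (B : Set ℍ) (z : ℍ) : ℝ≥0∞ :=
  (({w | ∃ γ ∈ Γ, γ • z = w} ∩ B).encard : ℝ≥0∞)

/-- The partial covering of `Γ \ ℍ` associated to a closed geodesic and `F`: each tile `γ F` crossed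
by the closed geodesic contributes its part to the left of the geodesic. -/
def partialCovering {Γ : Subgroup PSL(2, ℝ)} (F : Set ℍ) (c : ClosedGeodesic Γ) (z : ℍ) : ℝ≥0∞ :=
  ∑' γ : c.crossed F, coverCount Γ (c.leftSide ∩ (γ : PSL(2, ℝ)) • F) z

/-- The partial covering associated to a finite collection of closed geodesics. -/
def partialCoveringSum {Γ : Subgroup PSL(2, ℝ)} (F : Set ℍ) (C : Multiset (ClosedGeodesic Γ))
    (z : ℍ) : ℝ≥0∞ :=
  (C.map fun c ↦ partialCovering F c z).sum

/-- The volume of the part above `B` of the partial covering of `C`, for `B` a subset of the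
fundamental polygon `F`. For `B = F` this is the volume of the partial covering. -/
def coveringVolume {Γ : Subgroup PSL(2, ℝ)} (F : Set ℍ) (C : Multiset (ClosedGeodesic Γ))
    (B : Set ℍ) : ℝ≥0∞ :=
  ∫⁻ z in B, partialCoveringSum F C z

end HypSurface

end

/-!
The volume of a partial covering is a sum, over the crossed tiles `γ F`, of the area of the part of
`F` to the left of the geodesic moved back by `γ⁻¹` (`coveringVolume_eq`). Move the cusp to `∞` by
the scaling matrix. A convex polygon with a cusp at `∞` is a vertical strip `I × [y₀, ∞)` above some
height `y₀` (`exists_strip`), and `I` has length at most `1`.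

The core is an estimate for one crossing of one tile (`volume_halfPlane_inter_zone_le`). For a
half-plane and the zone of the tile above height `Y`, either the area of the half-plane in the zone
is at most `4 y₀ / Y` times its area in the tile, because it misses the zone or covers a definite
part of the tile; or its boundary geodesic stays in the tile for a time at least `log 2`, while the
zone has area at most `1 / Y`; or the boundary is a semicircle crossing the tile far up in the cusp
with the half-plane outside it. In the last case the area is `∫ dx / max Y y` along the semicircle,
and since `dx ≤ y dt` for the arc length `t`, it is at most `Y ^ (-1/2)` times the time spent in the
tile plus the time spent in the tile above height `Y ^ (1/2)`.

The times spent in the crossed tiles add up to at most the length, and the times spent in their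
zones to at most the time spent in the zone during one period (`tsum_crossed_le_timeIn`).
Equidistribution enters twice, both times through `eventually_le_sum_timeIn`. It shows that a
positive proportion of the time is spent in a small ball inside the tiles; every visit to the ball
cuts off a definite area, so the total length is bounded by a multiple of the volume of the covering
(`exists_totalLength_le`). It also shows that all but a proportion `O(1 / t)` of the time is spent
outside the zone of height `t`, which is used for `t = Y ^ (1/2)`
(`eventually_sum_timeIn_zone_le`). The constants in these two statements depend only on `F`, and
the dependence of `4 y₀ / Y` on the cusp is absorbed by taking `Y` large.
-/

noncomputable section

namespace HypSurface

/-! ### The action of `PSL(2, ℝ)` in coordinates -/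

theorem toPSL_smul (g : SL(2, ℝ)) (z : ℍ) : toPSL g • z = g • z := rfl

theorem toPSL_surjective : Function.Surjective toPSL := QuotientGroup.mk'_surjective _

instance : IsIsometricSMul PSL(2, ℝ) ℍ where
  isometry_smul g := by
    obtain ⟨h, rfl⟩ := toPSL_surjective g
    exact isometry_smul ℍ h

instance : SMulInvariantMeasure PSL(2, ℝ) ℍ volume where
  measure_preimage_smul g s hs := by
    obtain ⟨h, rfl⟩ := toPSL_surjective g
    exact measure_preimage_smul_of_nullMeasurableSet hs.nullMeasurableSet
      (Matrix.SpecialLinearGroup.toGL h)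

instance : Measure.IsOpenPosMeasure (volume : Measure ℍ) where
  open_pos U hU hne h := by
    have himg : IsOpen (UpperHalfPlane.coe '' U) :=
      UpperHalfPlane.isOpenEmbedding_coe.isOpenMap U hU
    rw [UpperHalfPlane.volume_eq_lintegral, lintegral_eq_zero_iff (by fun_prop),
      Filter.EventuallyEq, ae_restrict_iff' himg.measurableSet] at h
    have h0 : volume (UpperHalfPlane.coe '' U) = 0 := by
      refine measure_mono_null ?_ h
      rintro _ ⟨z, hz, rfl⟩ hcon
      have := hcon ⟨z, hz, rfl⟩
      simp [z.im_ne_zero] at this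
    exact himg.measure_ne_zero volume (hne.image _) h0

theorem coe_toPSL_smul (g : SL(2, ℝ)) (z : ℍ) :
    ((toPSL g • z : ℍ) : ℂ) = ((g 0 0 : ℂ) * z + g 0 1) / ((g 1 0 : ℂ) * z + g 1 1) := by
  rw [toPSL_smul, UpperHalfPlane.specialLinearGroup_apply]
  simp

theorem denom_sq_pos (g : SL(2, ℝ)) (z : ℍ) :
    0 < (g 1 0 * z.re + g 1 1) ^ 2 + (g 1 0 * z.im) ^ 2 := by
  have hdet := g.det_coe
  rw [Matrix.det_fin_two] at hdet
  by_cases hc : g 1 0 = 0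
  · have : g 1 1 ≠ 0 := by
      rintro h
      simp [hc, h] at hdet
    rw [hc]
    simp only [zero_mul, zero_add]
    positivity
  · have := z.im_pos
    positivity

theorem toPSL_smul_re (g : SL(2, ℝ)) (z : ℍ) :
    (toPSL g • z).re =
      (g 0 0 * g 1 0 * (z.re ^ 2 + z.im ^ 2) + (g 0 0 * g 1 1 + g 0 1 * g 1 0) * z.re +
        g 0 1 * g 1 1) / ((g 1 0 * z.re + g 1 1) ^ 2 + (g 1 0 * z.im) ^ 2) := by
  have h := congrArg Complex.re (coe_toPSL_smul g z)
  rw [UpperHalfPlane.coe_re] at h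
  rw [h, Complex.div_re]
  have := (denom_sq_pos g z).ne'
  simp [Complex.normSq_apply]
  field_simp
  ring

theorem toPSL_smul_im (g : SL(2, ℝ)) (z : ℍ) :
    (toPSL g • z).im = z.im / ((g 1 0 * z.re + g 1 1) ^ 2 + (g 1 0 * z.im) ^ 2) := by
  have h := congrArg Complex.im (coe_toPSL_smul g z)
  rw [UpperHalfPlane.coe_im] at h
  rw [h, Complex.div_im]
  have := (denom_sq_pos g z).ne'
  have hdet := g.det_coe
  rw [Matrix.det_fin_two] at hdet
  simp [Complex.normSq_apply]
  field_simp
  linear_combination hdet * ((g 1 0 * z.re + g 1 1) ^ 2 + (g 1 0 * z.im) ^ 2)⁻¹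

theorem diagElt_smul_re (t : ℝ) (z : ℍ) : (diagElt t • z).re = Real.exp t * z.re := by
  rw [diagElt, toPSL_smul_re]
  have : Real.exp t = Real.exp (t / 2) * Real.exp (t / 2) := by rw [← Real.exp_add]; ring_nf
  simp [diagMat, this, Real.exp_neg]
  field_simp

theorem diagElt_smul_im (t : ℝ) (z : ℍ) : (diagElt t • z).im = Real.exp t * z.im := by
  rw [diagElt, toPSL_smul_im]
  have : Real.exp t = Real.exp (t / 2) * Real.exp (t / 2) := by rw [← Real.exp_add]; ring_nf
  simp [diagMat, this, Real.exp_neg]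
  field_simp

theorem unipElt_smul_re (x : ℝ) (z : ℍ) : (unipElt x • z).re = z.re + x := by
  rw [unipElt, toPSL_smul_re]; simp [unipMat]

theorem unipElt_smul_im (x : ℝ) (z : ℍ) : (unipElt x • z).im = z.im := by
  rw [unipElt, toPSL_smul_im]; simp [unipMat]

theorem rotElt_smul_I (θ : ℝ) : rotElt θ • UpperHalfPlane.I = UpperHalfPlane.I := by
  have h1 := Real.sin_sq_add_cos_sq θ
  apply UpperHalfPlane.ext_re_im
  · rw [rotElt, toPSL_smul_re]; simp [rotMat]; ring
  · rw [rotElt, toPSL_smul_im]; simp [rotMat]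

theorem diagElt_add (s t : ℝ) : diagElt (s + t) = diagElt s * diagElt t := by
  rw [diagElt, diagElt, diagElt, ← map_mul]
  congr 1
  apply Subtype.ext
  rw [Matrix.SpecialLinearGroup.coe_mul]
  simp [diagMat, ← Real.exp_add, add_div, add_comm]

theorem diagElt_zero : diagElt 0 = 1 := by
  have := diagElt_add 0 0
  simpa using this

theorem diagElt_neg (t : ℝ) : diagElt (-t) = (diagElt t)⁻¹ :=
  eq_inv_of_mul_eq_one_left (by rw [← diagElt_add, neg_add_cancel, diagElt_zero])

/-- The unit speed geodesic through `g`, from `g(0)` to `g(∞)`. -/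
def flow (g : PSL(2, ℝ)) (t : ℝ) : ℍ := (g * diagElt t) • UpperHalfPlane.I

theorem smul_flow (g h : PSL(2, ℝ)) (t : ℝ) : g • flow h t = flow (g * h) t := by
  rw [flow, flow, smul_smul, mul_assoc]

theorem flow_re (h : SL(2, ℝ)) (t : ℝ) :
    (flow (toPSL h) t).re =
      (h 0 0 * h 1 0 * Real.exp t ^ 2 + h 0 1 * h 1 1) /
        (h 1 0 ^ 2 * Real.exp t ^ 2 + h 1 1 ^ 2) := by
  rw [flow, mul_smul, toPSL_smul_re, diagElt_smul_re, diagElt_smul_im]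
  simp
  ring

theorem flow_im (h : SL(2, ℝ)) (t : ℝ) :
    (flow (toPSL h) t).im = Real.exp t / (h 1 0 ^ 2 * Real.exp t ^ 2 + h 1 1 ^ 2) := by
  rw [flow, mul_smul, toPSL_smul_im, diagElt_smul_re, diagElt_smul_im]
  simp
  ring

theorem flow_denom_pos (h : SL(2, ℝ)) (t : ℝ) :
    0 < h 1 0 ^ 2 * Real.exp t ^ 2 + h 1 1 ^ 2 := by
  have := denom_sq_pos h (diagElt t • UpperHalfPlane.I)
  rw [diagElt_smul_re, diagElt_smul_im] at this
  simp at this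
  linarith

/-- The quadratic function whose sign decides on which side of the geodesic `h(0) → h(∞)` the point
`x + iy` lies: it is a positive multiple of `Re (h⁻¹ (x + iy))`, negative to the left. Its zero set
is a circle centred on the real axis if `h 1 0 * h 1 1 ≠ 0`, and a vertical line otherwise. -/
def sideForm (h : SL(2, ℝ)) (x y : ℝ) : ℝ :=
  -(h 1 0 * h 1 1) * (x ^ 2 + y ^ 2) + (h 0 0 * h 1 1 + h 0 1 * h 1 0) * x - h 0 0 * h 0 1

theorem exists_inv_smul_re_eq (h : SL(2, ℝ)) (z : ℍ) :
    ∃ D > 0, ((toPSL h)⁻¹ • z).re = sideForm h z.re z.im / D := by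
  rw [← map_inv]
  refine ⟨_, denom_sq_pos h⁻¹ z, ?_⟩
  rw [toPSL_smul_re]
  simp [Matrix.SpecialLinearGroup.coe_inv, Matrix.adjugate_fin_two, sideForm]
  ring

theorem inv_smul_re_nonpos_iff (h : SL(2, ℝ)) (z : ℍ) :
    ((toPSL h)⁻¹ • z).re ≤ 0 ↔ sideForm h z.re z.im ≤ 0 := by
  obtain ⟨D, hD, h⟩ := exists_inv_smul_re_eq h z
  rw [h, div_le_iff₀ hD, zero_mul]

theorem inv_smul_re_neg_iff (h : SL(2, ℝ)) (z : ℍ) :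
    ((toPSL h)⁻¹ • z).re < 0 ↔ sideForm h z.re z.im < 0 := by
  obtain ⟨D, hD, h⟩ := exists_inv_smul_re_eq h z
  rw [h, div_lt_iff₀ hD, zero_mul]

theorem sideForm_flow (h : SL(2, ℝ)) (t : ℝ) :
    sideForm h (flow (toPSL h) t).re (flow (toPSL h) t).im = 0 := by
  obtain ⟨D, hD, h'⟩ := exists_inv_smul_re_eq h (flow (toPSL h) t)
  rw [smul_flow, inv_mul_cancel, flow, one_mul, diagElt_smul_re] at h'
  have h0 := (div_eq_zero_iff.mp (h'.symm.trans (by simp)))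
  exact h0.resolve_right hD.ne'

theorem exists_flow_eq (h : SL(2, ℝ)) (z : ℍ) (hz : sideForm h z.re z.im = 0) :
    ∃ t, flow (toPSL h) t = z := by
  obtain ⟨D, hD, h'⟩ := exists_inv_smul_re_eq h z
  rw [hz, zero_div] at h'
  refine ⟨Real.log ((toPSL h)⁻¹ • z).im, ?_⟩
  rw [flow, mul_smul, ← eq_inv_smul_iff]
  apply UpperHalfPlane.ext_re_im
  · rw [diagElt_smul_re, h']; simp
  · rw [diagElt_smul_im, Real.exp_log (UpperHalfPlane.im_pos _)]; simp

theorem isOpen_openHalfPlane (g : PSL(2, ℝ)) : IsOpen (openHalfPlane g) :=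
  isOpen_Iio.preimage (UpperHalfPlane.continuous_re.comp (continuous_const_smul g⁻¹))

/-! ### Hyperbolic areas of vertical strips -/

theorem volume_setOf_re_im {A : Set (ℝ × ℝ)} (hpos : ∀ p ∈ A, 0 < p.2) :
    volume {z : ℍ | (z.re, z.im) ∈ A} = ∫⁻ p in A, ENNReal.ofReal (1 / p.2 ^ 2) := by
  have himg : UpperHalfPlane.coe '' {z : ℍ | (z.re, z.im) ∈ A} =
      Complex.measurableEquivRealProd ⁻¹' A := by
    ext w
    constructor
    · rintro ⟨z, hz, rfl⟩
      exact hz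
    · intro hw
      exact ⟨⟨w, hpos _ hw⟩, hw, rfl⟩
  rw [UpperHalfPlane.volume_eq_lintegral, himg,
    ← Complex.volume_preserving_equiv_real_prod.setLIntegral_comp_preimage_emb
      Complex.measurableEquivRealProd.measurableEmbedding]
  refine lintegral_congr fun z ↦ ?_
  rw [← ENNReal.ofReal_coe_nnreal]
  congr 1
  simp [Complex.measurableEquivRealProd]

theorem lintegral_Ici_one_div_sq {y : ℝ} (hy : 0 < y) :
    ∫⁻ t in Set.Ici y, ENNReal.ofReal (1 / t ^ 2) = ENNReal.ofReal (1 / y) := by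
  have h1 : Set.EqOn (fun t : ℝ ↦ 1 / t ^ 2) (fun t ↦ t ^ (-2 : ℝ)) (Set.Ioi y) := by
    intro t ht
    have : 0 < t := hy.trans ht
    simp only [Real.rpow_neg this.le, Real.rpow_two, one_div]
  rw [← restrict_Ioi_eq_restrict_Ici, ← ofReal_integral_eq_lintegral_ofReal]
  · rw [setIntegral_congr_fun measurableSet_Ioi h1, integral_Ioi_rpow_of_lt (by norm_num) hy]
    congr 1
    norm_num [Real.rpow_neg_one]
  · rw [← IntegrableOn, integrableOn_congr_fun h1 measurableSet_Ioi]
    exact integrableOn_Ioi_rpow_of_lt (by norm_num) hy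
  · exact ae_of_all _ fun t ↦ by positivity

/-- The area above the graph of a function. -/
theorem volume_epigraph {I : Set ℝ} (hI : MeasurableSet I) {f : ℝ → ℝ} (hf : Measurable f)
    (hpos : ∀ x, 0 < f x) :
    volume {z : ℍ | z.re ∈ I ∧ f z.re ≤ z.im} = ∫⁻ x in I, ENNReal.ofReal (1 / f x) := by
  have hm : MeasurableSet {p : ℝ × ℝ | f p.1 ≤ p.2} :=
    measurableSet_le (hf.comp measurable_fst) measurable_snd
  have hA : MeasurableSet {p : ℝ × ℝ | p.1 ∈ I ∧ f p.1 ≤ p.2} :=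
    (measurable_fst hI).inter hm
  have h := volume_setOf_re_im (A := {p : ℝ × ℝ | p.1 ∈ I ∧ f p.1 ≤ p.2})
    fun p hp ↦ (hpos _).trans_le hp.2
  simp only [Set.mem_ofPred_eq] at h
  rw [h, ← lintegral_indicator hA, Measure.volume_eq_prod,
    lintegral_prod _ ((Measurable.indicator (by fun_prop) hA).aemeasurable),
    ← lintegral_indicator hI]
  refine lintegral_congr fun x ↦ ?_
  by_cases hx : x ∈ I
  · rw [Set.indicator_of_mem hx, ← lintegral_Ici_one_div_sq (hpos x),
      ← lintegral_indicator measurableSet_Ici]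
    refine lintegral_congr fun y ↦ ?_
    simp [Set.indicator, hx]
  · simp [hx, Set.indicator]

theorem volume_strip {I : Set ℝ} (hI : MeasurableSet I) {y : ℝ} (hy : 0 < y) :
    volume {z : ℍ | z.re ∈ I ∧ y ≤ z.im} = volume I * ENNReal.ofReal (1 / y) := by
  rw [volume_epigraph hI measurable_const fun _ ↦ hy, setLIntegral_const, mul_comm]

theorem le_volume_strip_Icc {I : Set ℝ} (hI : MeasurableSet I) (hfin : volume I ≠ ⊤)
    {y : ℝ} (hy : 0 < y) :
    volume I * ENNReal.ofReal (1 / (2 * y)) ≤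
      volume {z : ℍ | z.re ∈ I ∧ y ≤ z.im ∧ z.im ≤ 2 * y} := by
  have hle : volume {z : ℍ | z.re ∈ I ∧ y ≤ z.im} ≤
      volume {z : ℍ | z.re ∈ I ∧ y ≤ z.im ∧ z.im ≤ 2 * y} +
        volume {z : ℍ | z.re ∈ I ∧ 2 * y ≤ z.im} := by
    refine (measure_mono ?_).trans (measure_union_le _ _)
    rintro z ⟨h1, h2⟩
    rcases le_total z.im (2 * y) with h | h
    · exact Or.inl ⟨h1, h2, h⟩
    · exact Or.inr ⟨h1, h⟩
  rw [volume_strip hI hy, volume_strip hI (by positivity)] at hle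
  have h2 : ENNReal.ofReal (1 / y) =
      ENNReal.ofReal (1 / (2 * y)) + ENNReal.ofReal (1 / (2 * y)) := by
    rw [← ENNReal.ofReal_add (by positivity) (by positivity)]
    congr 1
    field_simp
    norm_num
  rw [h2, mul_add] at hle
  exact ENNReal.le_of_add_le_add_right (ENNReal.mul_ne_top hfin ENNReal.ofReal_ne_top) hle

/-! ### Polygons near a cusp -/

/-- If the cusp `a = σ ∞` lies in the closure of `F` in the Riemann sphere, then `σ⁻¹ F` is
unbounded in the Euclidean sense. -/
theorem exists_smul_mem_of_mem_closure {F : Set ℍ} {a : OnePoint ℝ} {σ : PSL(2, ℝ)}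
    (hσ : σ • (OnePoint.infty : OnePoint ℝ) = a)
    (ha : OnePoint.map Complex.ofReal a ∈
      closure ((fun z : ℍ ↦ ((z : ℂ) : OnePoint ℂ)) '' F)) (R : ℝ) :
    ∃ z : ℍ, σ • z ∈ F ∧ R < ‖(z : ℂ)‖ := by
  obtain ⟨s, rfl⟩ := toPSL_surjective σ
  by_contra! hcon
  have hdet := s.det_coe
  rw [Matrix.det_fin_two] at hdet
  have hdetC : (s 0 0 : ℂ) * s 1 1 - s 0 1 * s 1 0 = 1 := by exact_mod_cast hdet
  have hne : ∀ z : ℍ, ((s 1 0 : ℂ) * z + s 1 1) ≠ 0 := fun z h0 ↦ by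
    have h1 := denom_sq_pos s z
    have h2 := congrArg Complex.re h0
    have h3 := congrArg Complex.im h0
    simp at h2 h3
    rw [h2] at h1
    rcases h3 with h3 | h3 <;> simp [h3] at h1
  have hR : ∀ w ∈ F, ∃ z : ℍ, toPSL s • z = w ∧ ‖(z : ℂ)‖ ≤ R := fun w hw ↦
    ⟨(toPSL s)⁻¹ • w, smul_inv_smul _ _, hcon _ (by rwa [smul_inv_smul])⟩
  have hsa : (Matrix.SpecialLinearGroup.toGL s) • (OnePoint.infty : OnePoint ℝ) = a := hσ
  rw [OnePoint.smul_infty_eq_ite] at hsa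
  by_cases hc : s 1 0 = 0
  · have ha' : a = OnePoint.infty := by
      rw [← hsa, if_pos]
      simpa using hc
    have hd : s 1 1 ≠ 0 := by rintro h; simp [h, hc] at hdet
    rw [ha', OnePoint.map_infty] at ha
    obtain ⟨B, hB⟩ : ∃ B, ∀ w ∈ F, ‖(w : ℂ)‖ ≤ B := by
      refine ⟨(|s 0 0| * R + |s 0 1|) / |s 1 1|, fun w hw ↦ ?_⟩
      obtain ⟨z, rfl, hz⟩ := hR w hw
      rw [coe_toPSL_smul, hc]
      simp only [Complex.ofReal_zero, zero_mul, zero_add, norm_div, Complex.norm_real,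
        Real.norm_eq_abs]
      gcongr
      refine (norm_add_le _ _).trans ?_
      simp only [norm_mul, Complex.norm_real, Real.norm_eq_abs]
      gcongr
    rw [mem_closure_iff] at ha
    obtain ⟨_, hx, w, hw, rfl⟩ := ha ((fun z : ℂ ↦ (z : OnePoint ℂ)) '' (Metric.closedBall 0 B))ᶜ
      (OnePoint.isOpen_compl_image_coe.mpr
        ⟨Metric.isClosed_closedBall, isCompact_closedBall _ _⟩) (by simp)
    exact hx ⟨w, by simpa using hB w hw, rfl⟩
  · have ha' : a = ((s 0 0 / s 1 0 : ℝ) : OnePoint ℝ) := by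
      rw [← hsa, if_neg]
      · simp
      · simpa using hc
    rw [ha', OnePoint.map_some] at ha
    set α : ℂ := ((s 0 0 / s 1 0 : ℝ) : ℂ) with hα
    have hcC : (s 1 0 : ℂ) ≠ 0 := by exact_mod_cast hc
    have hB : ∀ w ∈ F, 1 / (|s 1 0| * (|s 1 0| * |R| + |s 1 1| + 1)) ≤ ‖(w : ℂ) - α‖ := by
      intro w hw
      obtain ⟨z, rfl, hz⟩ := hR w hw
      have hz0 := hne z
      have : (((toPSL s • z : ℍ) : ℂ) - α) = -(1 / (s 1 0 * ((s 1 0 : ℂ) * z + s 1 1))) := by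
        rw [coe_toPSL_smul, hα]
        push_cast
        generalize hD : (s 1 0 : ℂ) * z + s 1 1 = D at hz0 ⊢
        rw [div_sub_div _ _ hz0 hcC, ← neg_div, div_eq_div_iff (mul_ne_zero hz0 hcC)
          (mul_ne_zero hcC hz0)]
        linear_combination (-D * s 1 0) * hdetC + (s 0 0 * D * s 1 0) * hD
      rw [this, norm_neg, norm_div, norm_one, norm_mul, Complex.norm_real, Real.norm_eq_abs]
      have h1 : ‖(s 1 0 : ℂ) * z + s 1 1‖ ≤ |s 1 0| * |R| + |s 1 1| + 1 := by
        refine ((norm_add_le _ _).trans ?_)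
        simp only [norm_mul, Complex.norm_real, Real.norm_eq_abs]
        have : ‖(z : ℂ)‖ ≤ |R| := hz.trans (le_abs_self _)
        nlinarith [abs_nonneg (s 1 0)]
      have h2 : 0 < ‖(s 1 0 : ℂ) * z + s 1 1‖ := norm_pos_iff.mpr hz0
      have h3 : 0 < |s 1 0| := abs_pos.mpr hc
      gcongr
    set ε := 1 / (|s 1 0| * (|s 1 0| * |R| + |s 1 1| + 1)) with hε
    have hεpos : 0 < ε := by
      have h3 : 0 < |s 1 0| := abs_pos.mpr hc
      positivity
    rw [mem_closure_iff] at ha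
    obtain ⟨_, ⟨v, hv, hvw⟩, w, hw, rfl⟩ := ha ((fun z : ℂ ↦ (z : OnePoint ℂ)) '' (Metric.ball α ε))
      (OnePoint.isOpen_image_coe.mpr Metric.isOpen_ball) ⟨α, by simpa using hεpos, rfl⟩
    have hvw' : v = (w : ℂ) := OnePoint.coe_injective hvw
    rw [hvw', Metric.mem_ball, dist_eq_norm] at hv
    exact absurd (hB w hw) (not_le.mpr hv)

/-- A half-plane that contains an unbounded set is not the inside of a semicircle, so at large
heights it is given by a condition on the real part alone. -/
theorem exists_strip_halfPlane (h : SL(2, ℝ))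
    (hunb : ∀ R, ∃ z : ℍ, sideForm h z.re z.im < 0 ∧ R < ‖(z : ℂ)‖) :
    ∃ I : Set ℝ, IsOpen I ∧ I.OrdConnected ∧ (∀ z : ℍ, sideForm h z.re z.im < 0 → z.re ∈ I) ∧
      ∃ y₀ > 0, ∀ z : ℍ, y₀ ≤ z.im → z.re ∈ I → sideForm h z.re z.im < 0 := by
  have hdet := h.det_coe
  rw [Matrix.det_fin_two] at hdet
  rcases lt_trichotomy (h 1 0 * h 1 1) 0 with hneg | h0 | hpos
  · -- The half-plane is the inside of a semicircle, which is bounded.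
    exfalso
    set k := -(h 1 0 * h 1 1) with hk
    set m := h 0 0 * h 1 1 + h 0 1 * h 1 0 with hm
    set n := h 0 0 * h 0 1 with hn
    have hkpos : 0 < k := by rw [hk]; linarith
    obtain ⟨z, hz, hzR⟩ := hunb (1 + (|m| + |n|) / k)
    have hnorm : ‖(z : ℂ)‖ ^ 2 = z.re ^ 2 + z.im ^ 2 := by
      rw [← Complex.normSq_eq_norm_sq, Complex.normSq_apply]; simp; ring
    have hre : |z.re| ≤ ‖(z : ℂ)‖ := Complex.abs_re_le_norm _
    have hz' : k * ‖(z : ℂ)‖ ^ 2 + m * z.re - n < 0 := by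
      rw [hnorm]; exact hz
    set r := ‖(z : ℂ)‖
    have hr1 : 1 < r := by
      have : 0 ≤ (|m| + |n|) / k := by positivity
      linarith
    have hr2 : |m| + |n| < k * r := by
      have : (|m| + |n|) / k < r := by linarith
      rwa [div_lt_iff₀ hkpos, mul_comm] at this
    have h1 : |m * z.re| ≤ |m| * r := by rw [abs_mul]; gcongr
    have h2 := neg_abs_le (m * z.re)
    have h3 := le_abs_self n
    nlinarith [abs_nonneg n]
  · refine ⟨{x | (h 0 0 * h 1 1 + h 0 1 * h 1 0) * x - h 0 0 * h 0 1 < 0},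
      isOpen_lt (by fun_prop) (by fun_prop), ?_, fun z hz ↦ ?_, 1, one_pos, fun z _ hz ↦ ?_⟩
    · refine ⟨fun x hx y hy w hw ↦ ?_⟩
      simp only [Set.mem_ofPred_eq] at hx hy ⊢
      rcases le_total 0 (h 0 0 * h 1 1 + h 0 1 * h 1 0) with hm | hm
      · nlinarith [hw.2]
      · nlinarith [hw.1]
    · simpa [sideForm, h0] using hz
    · simpa [sideForm, h0] using hz
  · -- The half-plane is the outside of a semicircle of radius `1 / (2 * h 1 0 * h 1 1)`.
    refine ⟨Set.univ, isOpen_univ, Set.ordConnected_univ, fun z hz ↦ trivial,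
      1 / (h 1 0 * h 1 1), by positivity, fun z hz _ ↦ ?_⟩
    rw [div_le_iff₀ hpos] at hz
    rw [sideForm]
    set k := h 1 0 * h 1 1 with hk
    set m := h 0 0 * h 1 1 + h 0 1 * h 1 0 with hm
    have hdisc : m ^ 2 - 4 * k * (h 0 0 * h 0 1) = 1 := by
      rw [hm, hk]; linear_combination (h 0 0 * h 1 1 - h 0 1 * h 1 0 + 1) * hdet
    have h1 : 1 ≤ (z.im * k) ^ 2 := by nlinarith
    have h2 := sq_nonneg (2 * k * z.re - m)
    have h3 : 4 * k * (-k * (z.re ^ 2 + z.im ^ 2) + m * z.re - h 0 0 * h 0 1) < 0 := by nlinarith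
    by_contra hcon
    push Not at hcon
    nlinarith

/-- In coordinates where the cusp is `∞`, a polygon is a vertical strip near the cusp. -/
theorem exists_strip {F : Set ℍ} (hpoly : ∃ S : Finset PSL(2, ℝ), F = ⋂ g ∈ S, openHalfPlane g)
    (hne : F.Nonempty) {a : OnePoint ℝ} {σ : PSL(2, ℝ)}
    (hσ : σ • (OnePoint.infty : OnePoint ℝ) = a)
    (ha : OnePoint.map Complex.ofReal a ∈
      closure ((fun z : ℍ ↦ ((z : ℂ) : OnePoint ℂ)) '' F)) :
    ∃ I : Set ℝ, IsOpen I ∧ I.OrdConnected ∧ I.Nonempty ∧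
      ∃ y₀ > 0, ∀ z : ℍ, y₀ ≤ z.im → (σ • z ∈ F ↔ z.re ∈ I) := by
  obtain ⟨S, hS⟩ := hpoly
  have hunb := exists_smul_mem_of_mem_closure hσ ha
  have key : ∀ g ∈ S, ∃ I : Set ℝ, IsOpen I ∧ I.OrdConnected ∧
      (∀ z : ℍ, σ • z ∈ openHalfPlane g → z.re ∈ I) ∧
      ∃ y₀ > 0, ∀ z : ℍ, y₀ ≤ z.im → z.re ∈ I → σ • z ∈ openHalfPlane g := by
    intro g hg
    obtain ⟨h, hh⟩ := toPSL_surjective (σ⁻¹ * g)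
    have hiff : ∀ z : ℍ, σ • z ∈ openHalfPlane g ↔ sideForm h z.re z.im < 0 := by
      intro z
      rw [← inv_smul_re_neg_iff, hh, mul_inv_rev, inv_inv, mul_smul]
      rfl
    simp only [hiff]
    refine exists_strip_halfPlane h fun R ↦ ?_
    obtain ⟨z, hz, hzR⟩ := hunb R
    refine ⟨z, (hiff z).mp ?_, hzR⟩
    rw [hS] at hz
    exact Set.mem_iInter₂.mp hz g hg
  choose! I hIo hIc hI y₀ hy₀ hy using key
  refine ⟨⋂ g ∈ S, I g, isOpen_biInter_finset hIo,
    Set.ordConnected_biInter fun g hg ↦ hIc g hg, ?_, 1 + ∑ g ∈ S, |y₀ g|, by positivity, ?_⟩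
  · obtain ⟨w, hw⟩ := hne
    refine ⟨(σ⁻¹ • w).re, Set.mem_iInter₂.mpr fun g hg ↦ hI g hg _ ?_⟩
    rw [smul_inv_smul]
    rw [hS] at hw
    exact Set.mem_iInter₂.mp hw g hg
  · intro z hz
    rw [hS]
    simp only [Set.mem_iInter]
    refine ⟨fun h g hg ↦ hI g hg _ (h g hg), fun h g hg ↦ hy g hg _ ?_ (h g hg)⟩
    have := Finset.single_le_sum (f := fun g ↦ |y₀ g|) (fun i _ ↦ abs_nonneg _) hg
    have := le_abs_self (y₀ g)
    linarith

/-! ### A geodesic crossing a tile -/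

theorem dist_flow (g : PSL(2, ℝ)) (s t : ℝ) : dist (flow g s) (flow g t) = |s - t| := by
  rw [flow, flow, mul_smul, mul_smul, dist_smul, UpperHalfPlane.dist_of_re_eq]
  · rw [diagElt_smul_im, diagElt_smul_im]
    simp [Real.dist_eq]
  · simp [diagElt_smul_re]

theorem continuous_flow (g : PSL(2, ℝ)) : Continuous (flow g) :=
  (Isometry.of_dist_eq fun s t ↦ by rw [dist_flow, Real.dist_eq]).continuous

/-- Convexity of half-planes: the sign of the real part along a geodesic is that of an affine
function of `exp t ^ 2`. -/
theorem ordConnected_flow_mem_openHalfPlane (g k : PSL(2, ℝ)) :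
    {t | flow g t ∈ openHalfPlane k}.OrdConnected := by
  obtain ⟨h, hh⟩ := toPSL_surjective (k⁻¹ * g)
  have hiff : ∀ t, flow g t ∈ openHalfPlane k ↔
      h 0 0 * h 1 0 * Real.exp t ^ 2 + h 0 1 * h 1 1 < 0 := by
    intro t
    rw [openHalfPlane, Set.mem_ofPred_eq, smul_flow, ← hh, flow_re,
      div_lt_iff₀ (flow_denom_pos h t), zero_mul]
  simp only [hiff]
  refine ⟨fun s hs t ht u hu ↦ ?_⟩
  have h1 : Real.exp s ^ 2 ≤ Real.exp u ^ 2 := by gcongr; exact hu.1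
  have h2 : Real.exp u ^ 2 ≤ Real.exp t ^ 2 := by gcongr; exact hu.2
  simp only [Set.mem_ofPred_eq] at hs ht ⊢
  rcases le_total 0 (h 0 0 * h 1 0) with hm | hm <;> nlinarith

theorem ordConnected_flow_mem {F : Set ℍ}
    (hpoly : ∃ S : Finset PSL(2, ℝ), F = ⋂ g ∈ S, openHalfPlane g) (k g : PSL(2, ℝ)) :
    {t | flow g t ∈ k • F}.OrdConnected := by
  obtain ⟨S, rfl⟩ := hpoly
  have : {t | flow g t ∈ k • ⋂ k ∈ S, openHalfPlane k} =
      ⋂ k' ∈ S, {t | flow (k⁻¹ * g) t ∈ openHalfPlane k'} := by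
    ext t
    simp only [Set.mem_ofPred_eq, Set.mem_smul_set_iff_inv_smul_mem, smul_flow, Set.mem_iInter]
  rw [this]
  exact Set.ordConnected_biInter fun _ _ ↦ ordConnected_flow_mem_openHalfPlane _ _

theorem continuous_sideForm (h : SL(2, ℝ)) :
    Continuous fun p : ℝ × ℝ ↦ sideForm h p.1 p.2 := by
  unfold sideForm; fun_prop

theorem sideForm_neg_or_pos (h : SL(2, ℝ)) {S : Set (ℝ × ℝ)} (hS : IsPreconnected S)
    (hne : ∀ p ∈ S, sideForm h p.1 p.2 ≠ 0) :
    (∀ p ∈ S, sideForm h p.1 p.2 < 0) ∨ (∀ p ∈ S, 0 < sideForm h p.1 p.2) := by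
  by_contra! hcon
  obtain ⟨⟨p, hp, hp0⟩, ⟨q, hq, hq0⟩⟩ := hcon
  obtain ⟨r, hr, hr0⟩ := hS.intermediate_value hq hp (continuous_sideForm h).continuousOn
    (Set.mem_Icc.mpr ⟨hq0, hp0⟩)
  exact hne r hr hr0

theorem hasDerivAt_flow_re (h : SL(2, ℝ)) (t : ℝ) :
    HasDerivAt (fun t ↦ (flow (toPSL h) t).re)
      (2 * (h 1 0 * h 1 1) * (flow (toPSL h) t).im ^ 2) t := by
  have hdet := h.det_coe
  rw [Matrix.det_fin_two] at hdet
  have hD := (flow_denom_pos h t).ne'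
  have he : HasDerivAt (fun t ↦ Real.exp t ^ 2) (2 * Real.exp t ^ 2) t := by
    refine ((Real.hasDerivAt_exp t).pow 2).congr_deriv ?_
    push_cast
    ring
  have h1 := ((he.const_mul (h 0 0 * h 1 0)).add_const (h 0 1 * h 1 1)).div
    ((he.const_mul (h 1 0 ^ 2)).add_const (h 1 1 ^ 2)) hD
  have h2 : (fun t ↦ (flow (toPSL h) t).re) = fun t ↦
      (h 0 0 * h 1 0 * Real.exp t ^ 2 + h 0 1 * h 1 1) /
        (h 1 0 ^ 2 * Real.exp t ^ 2 + h 1 1 ^ 2) := funext fun t ↦ flow_re h t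
  rw [h2]
  convert! h1 using 1
  rw [flow_im, div_pow, ← mul_div_assoc]
  congr 1
  linear_combination (-2 * h 1 0 * h 1 1 * Real.exp t ^ 2) * hdet

theorem two_mul_mul_flow_im_le (h : SL(2, ℝ)) (t : ℝ) :
    2 * (h 1 0 * h 1 1) * (flow (toPSL h) t).im ≤ 1 := by
  rw [flow_im, ← mul_div_assoc, div_le_one (flow_denom_pos h t)]
  nlinarith [sq_nonneg (h 1 0 * Real.exp t - h 1 1)]

/-- Suppose that the half-plane is the outside of a semicircle (`hcd`), and that the semicircle lies
in the tile `G` over all of `I` (`hIG`). Then the part of the half-plane over `I` and above height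
`Y` has area `∫ dx / max Y y`, integrated along the semicircle. Parametrized by arc length,
`dx = 2 h₁₀ h₁₁ y² dt ≤ y dt`, so that the area is at most the integral of
`y / max Y y ≤ 1 / √Y + 1_{y ≥ √Y}` over the time spent in `G`. -/
theorem volume_above_geodesic_le {G : Set ℍ} {I : Set ℝ} (hI : MeasurableSet I) (h : SL(2, ℝ))
    (hcd : 0 < h 1 0 * h 1 1) {Y : ℝ} (hY : 1 ≤ Y)
    (hτ : MeasurableSet {t | flow (toPSL h) t ∈ G})
    (hIG : ∀ x ∈ I, 0 < sideForm h x 0 ∧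
      ∀ z : ℍ, z.re = x → sideForm h z.re z.im = 0 → z ∈ G) :
    volume {z : ℍ | ((toPSL h)⁻¹ • z).re ≤ 0 ∧ z.re ∈ I ∧ Y ≤ z.im} ≤
      ENNReal.ofReal (1 / √Y) * volume {t | flow (toPSL h) t ∈ G} +
        volume {t | flow (toPSL h) t ∈ G ∧ √Y ≤ (flow (toPSL h) t).im} := by
  have hY0 : 0 < Y := by linarith
  have hr0 : 0 < √Y := Real.sqrt_pos.mpr hY0
  have hrr : √Y * √Y = Y := Real.mul_self_sqrt hY0.le
  have hsplit : ∀ x y, sideForm h x y = sideForm h x 0 - h 1 0 * h 1 1 * y ^ 2 := by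
    intro x y; simp only [sideForm]; ring
  -- `η x` is the height of the semicircle over `x`.
  set η : ℝ → ℝ := fun x ↦ √(sideForm h x 0 / (h 1 0 * h 1 1)) with hη
  set τ := {t | flow (toPSL h) t ∈ G} with hτdef
  set φ : ℝ → ℝ := fun t ↦ (flow (toPSL h) t).re with hφ
  have hηmeas : Measurable η := by
    have : Continuous fun x ↦ sideForm h x 0 := by unfold sideForm; fun_prop
    exact (this.div_const _).measurable.sqrt
  have hηflow : ∀ t, η (φ t) = (flow (toPSL h) t).im := by
    intro t
    have h0 := sideForm_flow h t
    rw [hsplit] at h0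
    have : sideForm h (φ t) 0 / (h 1 0 * h 1 1) = (flow (toPSL h) t).im ^ 2 := by
      rw [div_eq_iff hcd.ne']
      simp only [hφ]
      linarith
    simp only [hη]
    rw [this, Real.sqrt_sq (UpperHalfPlane.im_pos _).le]
  have hsub : {z : ℍ | ((toPSL h)⁻¹ • z).re ≤ 0 ∧ z.re ∈ I ∧ Y ≤ z.im} ⊆
      {z : ℍ | z.re ∈ I ∧ max Y (η z.re) ≤ z.im} := by
    rintro z ⟨hz1, hz2, hz3⟩
    refine ⟨hz2, max_le hz3 ?_⟩
    rw [inv_smul_re_nonpos_iff, hsplit] at hz1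
    refine Real.sqrt_le_iff.mpr ⟨z.im_pos.le, ?_⟩
    rw [div_le_iff₀ hcd]
    linarith
  have hIφ : I ⊆ φ '' τ := by
    intro x hx
    obtain ⟨hx0, hxG⟩ := hIG x hx
    have hηx : 0 < η x := Real.sqrt_pos.mpr (div_pos hx0 hcd)
    have hηsq : η x ^ 2 = sideForm h x 0 / (h 1 0 * h 1 1) := Real.sq_sqrt (div_pos hx0 hcd).le
    let z : ℍ := ⟨⟨x, η x⟩, hηx⟩
    have hz : sideForm h z.re z.im = 0 := by
      rw [hsplit]
      change sideForm h x 0 - h 1 0 * h 1 1 * η x ^ 2 = 0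
      rw [hηsq, mul_div_cancel₀ _ hcd.ne', sub_self]
    obtain ⟨t, ht⟩ := exists_flow_eq h z hz
    refine ⟨t, ?_, ?_⟩
    · rw [hτdef, Set.mem_ofPred_eq, ht]
      exact hxG z rfl hz
    · simp only [hφ, ht]; rfl
  have hinj : Set.InjOn φ τ := by
    refine StrictMono.injective ?_ |>.injOn
    refine strictMono_of_hasDerivAt_pos (fun t ↦ hasDerivAt_flow_re h t) fun t ↦ ?_
    have := UpperHalfPlane.im_pos (flow (toPSL h) t)
    positivity
  calc volume {z : ℍ | ((toPSL h)⁻¹ • z).re ≤ 0 ∧ z.re ∈ I ∧ Y ≤ z.im}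
      ≤ volume {z : ℍ | z.re ∈ I ∧ max Y (η z.re) ≤ z.im} := measure_mono hsub
    _ = ∫⁻ x in I, ENNReal.ofReal (1 / max Y (η x)) :=
        volume_epigraph hI (measurable_const.max hηmeas) fun x ↦ lt_max_of_lt_left hY0
    _ ≤ ∫⁻ x in φ '' τ, ENNReal.ofReal (1 / max Y (η x)) := lintegral_mono_set hIφ
    _ = ∫⁻ t in τ, ENNReal.ofReal |2 * (h 1 0 * h 1 1) * (flow (toPSL h) t).im ^ 2| *
          ENNReal.ofReal (1 / max Y (η (φ t))) :=
        lintegral_image_eq_lintegral_abs_deriv_mul hτ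
          (fun t _ ↦ (hasDerivAt_flow_re h t).hasDerivWithinAt) hinj _
    _ ≤ ∫⁻ t in τ, (ENNReal.ofReal (1 / √Y) +
          {t | √Y ≤ (flow (toPSL h) t).im}.indicator 1 t) := by
        refine lintegral_mono fun t ↦ ?_
        rw [hηflow, ← ENNReal.ofReal_mul (abs_nonneg _)]
        have hy := UpperHalfPlane.im_pos (flow (toPSL h) t)
        have h2 := two_mul_mul_flow_im_le h t
        set y := (flow (toPSL h) t).im
        have hmax : 0 < max Y y := lt_max_of_lt_left hY0
        have h3 : |2 * (h 1 0 * h 1 1) * y ^ 2| * (1 / max Y y) ≤ y / max Y y := by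
          rw [abs_of_nonneg (by positivity), mul_one_div]
          gcongr
          nlinarith
        by_cases hyY : √Y ≤ y
        · rw [Set.indicator_of_mem (by exact hyY)]
          refine le_trans ?_ le_add_self
          rw [Pi.one_apply, ENNReal.ofReal_le_one]
          refine h3.trans ((div_le_one hmax).mpr (le_max_right _ _))
        · rw [Set.indicator_of_notMem (by exact hyY), add_zero]
          refine ENNReal.ofReal_le_ofReal (h3.trans ?_)
          rw [div_le_div_iff₀ hmax hr0]
          push Not at hyY
          nlinarith [le_max_left Y y]
    _ = ENNReal.ofReal (1 / √Y) * volume τ +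
          volume {t | flow (toPSL h) t ∈ G ∧ √Y ≤ (flow (toPSL h) t).im} := by
        have hm : MeasurableSet {t | √Y ≤ (flow (toPSL h) t).im} :=
          (isClosed_le continuous_const
            (UpperHalfPlane.continuous_im.comp (continuous_flow _))).measurableSet
        rw [lintegral_add_left measurable_const, setLIntegral_const, lintegral_indicator_one hm,
          Measure.restrict_apply hm]
        congr 2
        ext t
        exact and_comm

/-- The area of the part of a half-plane above height `Y` of a tile with a cusp at `∞` is
controlled by the area of its intersection with the tile, and by the time its boundary geodesic
spends in the tile and in the cuspidal zone. -/
theorem volume_halfPlane_inter_zone_le {G : Set ℍ} {I : Set ℝ} (hI : IsOpen I)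
    (hIc : I.OrdConnected) (hI1 : volume I ≤ 1) {y₀ : ℝ} (hy₀ : 0 < y₀)
    (hG : ∀ z : ℍ, y₀ ≤ z.im → (z ∈ G ↔ z.re ∈ I)) (g : PSL(2, ℝ))
    (hτ : {t | flow g t ∈ G}.OrdConnected) {Y : ℝ} (hY : 1 ≤ Y) (hYy : 4 * y₀ ≤ Y) :
    volume {z : ℍ | (g⁻¹ • z).re ≤ 0 ∧ z ∈ G ∧ Y ≤ z.im} ≤
      ENNReal.ofReal (4 * y₀ / Y) * volume {z : ℍ | (g⁻¹ • z).re ≤ 0 ∧ z ∈ G} +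
        (ENNReal.ofReal (2 / √Y) * volume {t | flow g t ∈ G} +
          volume {t | flow g t ∈ G ∧ √Y ≤ (flow g t).im}) := by
  obtain ⟨h, rfl⟩ := toPSL_surjective g
  have hY0 : 0 < Y := by linarith
  have hr0 : 0 < √Y := Real.sqrt_pos.mpr hY0
  have hrr : √Y * √Y = Y := Real.mul_self_sqrt hY0.le
  have hr1 : 1 ≤ √Y := Real.one_le_sqrt.mpr hY
  have hImeas := hI.measurableSet
  have hIconv : Convex ℝ I := hIc.convex
  have hItop : volume I ≠ ⊤ := (hI1.trans_lt ENNReal.one_lt_top).ne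
  have hzero : ∀ x ∈ I, ∀ y, y₀ ≤ y → sideForm h x y = 0 →
      ∃ t, flow (toPSL h) t ∈ G ∧ (flow (toPSL h) t).im = y := by
    intro x hx y hy h0
    obtain ⟨t, ht⟩ := exists_flow_eq h ⟨⟨x, y⟩, hy₀.trans_le hy⟩ h0
    refine ⟨t, ?_, ?_⟩
    · exact ht ▸ (hG ⟨⟨x, y⟩, hy₀.trans_le hy⟩ hy).mpr hx
    · rw [ht]; rfl
  have hset : {z : ℍ | ((toPSL h)⁻¹ • z).re ≤ 0 ∧ z ∈ G ∧ Y ≤ z.im} =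
      {z : ℍ | ((toPSL h)⁻¹ • z).re ≤ 0 ∧ z.re ∈ I ∧ Y ≤ z.im} := by
    ext z
    refine and_congr_right fun _ ↦ and_congr_left fun hz ↦ hG z (by linarith)
  have hle : volume {z : ℍ | ((toPSL h)⁻¹ • z).re ≤ 0 ∧ z ∈ G ∧ Y ≤ z.im} ≤
      volume I * ENNReal.ofReal (1 / Y) := by
    rw [← volume_strip hImeas hY0, hset]
    exact measure_mono fun z hz ↦ hz.2
  have harea : ∀ b, 0 < b → b ≤ 4 * y₀ →
      volume I * ENNReal.ofReal (1 / b) ≤ volume {z : ℍ | ((toPSL h)⁻¹ • z).re ≤ 0 ∧ z ∈ G} →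
      volume {z : ℍ | ((toPSL h)⁻¹ • z).re ≤ 0 ∧ z ∈ G ∧ Y ≤ z.im} ≤
      ENNReal.ofReal (4 * y₀ / Y) * volume {z : ℍ | ((toPSL h)⁻¹ • z).re ≤ 0 ∧ z ∈ G} := by
    intro b hb hb4 hV
    refine (hle.trans ?_).trans (mul_le_mul_right hV _)
    rw [mul_left_comm, ← ENNReal.ofReal_mul (by positivity)]
    gcongr
    rw [div_mul_div_comm, div_le_div_iff₀ hY0 (by positivity)]
    nlinarith
  -- If the geodesic stays below height `4 y₀` in the tile, then the whole cusp above that height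
  -- lies on one side of it.
  by_cases hhigh : ∃ t, flow (toPSL h) t ∈ G ∧ 4 * y₀ ≤ (flow (toPSL h) t).im
  swap
  · refine le_trans ?_ le_self_add
    have hne : ∀ p ∈ I ×ˢ Set.Ici (4 * y₀), sideForm h p.1 p.2 ≠ 0 := by
      rintro ⟨x, y⟩ ⟨hx, hy⟩ h0
      have hy' : 4 * y₀ ≤ y := hy
      obtain ⟨t, ht, hty⟩ := hzero x hx y (by linarith) h0
      exact hhigh ⟨t, ht, hty ▸ hy'⟩
    rcases sideForm_neg_or_pos h (hIconv.prod (convex_Ici _)).isPreconnected hne with hneg | hpos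
    · refine harea (4 * y₀) (by positivity) le_rfl ?_
      rw [← volume_strip hImeas (by positivity)]
      refine measure_mono fun z hz ↦ ⟨?_, ?_⟩
      · exact (inv_smul_re_nonpos_iff h z).mpr (hneg (z.re, z.im) hz).le
      · exact (hG z (by linarith [hz.2])).mpr hz.1
    · rw [hset]
      refine (measure_mono_null (t := ∅) ?_ measure_empty).trans_le zero_le
      rintro z ⟨hz1, hz2, hz3⟩
      rw [inv_smul_re_nonpos_iff] at hz1
      exact absurd hz1 (not_le.mpr (hpos (z.re, z.im) ⟨hz2, hYy.trans hz3⟩))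
  obtain ⟨t₁, ht₁, hy₁⟩ := hhigh
  -- A geodesic that reaches height `4 y₀` and comes below `2 y₀` in the tile spends time at least
  -- `log 2` in it.
  by_cases hlow : ∃ t, flow (toPSL h) t ∈ G ∧ (flow (toPSL h) t).im ≤ 2 * y₀
  · obtain ⟨t₂, ht₂, hy₂⟩ := hlow
    refine le_trans ?_ (le_add_self.trans' le_self_add)
    have hlog : 1 / 2 ≤ |t₁ - t₂| := by
      rw [← dist_flow (toPSL h)]
      refine le_trans ?_ (UpperHalfPlane.dist_log_im_le _ _)
      refine le_trans ?_ (le_abs_self _)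
      rw [← Real.log_div (UpperHalfPlane.im_ne_zero _) (UpperHalfPlane.im_ne_zero _)]
      have h2 : (2 : ℝ) ≤ (flow (toPSL h) t₁).im / (flow (toPSL h) t₂).im := by
        rw [le_div_iff₀ (UpperHalfPlane.im_pos _)]
        linarith
      have := Real.log_le_log (by norm_num) h2
      linarith [Real.log_two_gt_d9]
    have hvol : ENNReal.ofReal (1 / 2) ≤ volume {t | flow (toPSL h) t ∈ G} := by
      refine le_trans ?_ (measure_mono (hτ.uIcc_subset ht₂ ht₁))
      rw [Real.volume_interval]
      exact ENNReal.ofReal_le_ofReal hlog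
    refine (hle.trans ?_).trans (mul_le_mul_right hvol _)
    refine (mul_le_mul_left hI1 _).trans ?_
    rw [one_mul, ← ENNReal.ofReal_mul (by positivity)]
    refine ENNReal.ofReal_le_ofReal ?_
    rw [div_mul_div_comm, div_le_div_iff₀ hY0 (by positivity)]
    nlinarith
  -- Otherwise the box `I × [y₀, 2 y₀]` lies on one side. If it is on the left, it gives the tile
  -- enough area; if not, the geodesic is a semicircle above the box, with its outside on the left.
  have hne : ∀ p ∈ I ×ˢ Set.Icc y₀ (2 * y₀), sideForm h p.1 p.2 ≠ 0 := by
    rintro ⟨x, y⟩ ⟨hx, hy⟩ h0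
    obtain ⟨t, ht, hty⟩ := hzero x hx y hy.1 h0
    exact hlow ⟨t, ht, hty ▸ hy.2⟩
  rcases sideForm_neg_or_pos h (hIconv.prod (convex_Icc _ _)).isPreconnected hne with hneg | hpos
  · refine le_trans (harea (2 * y₀) (by positivity) (by linarith) ?_) le_self_add
    refine (le_volume_strip_Icc hImeas hItop hy₀).trans (measure_mono fun z hz ↦ ⟨?_, ?_⟩)
    · exact (inv_smul_re_nonpos_iff h z).mpr (hneg (z.re, z.im) hz).le
    · exact (hG z hz.2.1).mpr hz.1
  · refine le_trans ?_ le_add_self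
    have hx₁ : (flow (toPSL h) t₁).re ∈ I := (hG _ (by linarith)).mp ht₁
    have hcd : 0 < h 1 0 * h 1 1 := by
      have h1 := hpos ((flow (toPSL h) t₁).re, 2 * y₀) ⟨hx₁, by simp; linarith⟩
      have h2 := sideForm_flow h t₁
      simp only [sideForm] at h1 h2
      have h3 : (4 * y₀) ^ 2 ≤ (flow (toPSL h) t₁).im ^ 2 := by gcongr
      by_contra! hcon
      nlinarith [mul_nonneg (neg_nonneg.mpr hcon)
        (by nlinarith : 0 ≤ (flow (toPSL h) t₁).im ^ 2 - (2 * y₀) ^ 2)]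
    rw [hset]
    refine (volume_above_geodesic_le hImeas h hcd hY hτ.measurableSet fun x hx ↦ ?_).trans
      (add_le_add_left (mul_le_mul_left (ENNReal.ofReal_le_ofReal (by gcongr; norm_num)) _) _)
    have h1 : 0 < sideForm h x (2 * y₀) := hpos (x, 2 * y₀) ⟨hx, by simp; linarith⟩
    refine ⟨by simp only [sideForm] at h1 ⊢; nlinarith, fun z hzx hz ↦ ?_⟩
    refine (hG z ?_).mpr (hzx ▸ hx)
    subst hzx
    have : 2 * y₀ < z.im := by
      by_contra! hcon
      have h3 : z.im ^ 2 ≤ (2 * y₀) ^ 2 := by gcongr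
      simp only [sideForm] at h1 hz
      nlinarith
    linarith

/-! ### Fundamental polygons -/

/-- `PSL(2, ℝ)` acts freely on germs: an element that fixes a neighbourhood of a point pointwise is
trivial. -/
theorem eq_one_of_eventually_smul_eq {g : PSL(2, ℝ)} {z : ℍ} (h : ∀ᶠ w in 𝓝 z, g • w = w) :
    g = 1 := by
  obtain ⟨s, rfl⟩ := toPSL_surjective g
  have hfix : ∀ w : ℍ, toPSL s • w = w →
      s 1 0 * (w.re ^ 2 - w.im ^ 2) + (s 1 1 - s 0 0) * w.re - s 0 1 = 0 ∧
        2 * s 1 0 * w.re + (s 1 1 - s 0 0) = 0 := by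
    intro w hw
    have h1 := congrArg UpperHalfPlane.coe hw
    have h0 : (s 1 0 : ℂ) * w + s 1 1 ≠ 0 := by
      intro h0
      rw [coe_toPSL_smul, h0, div_zero] at h1
      exact w.ne_zero h1.symm
    rw [coe_toPSL_smul, div_eq_iff h0] at h1
    have hre := congrArg Complex.re h1
    have him := congrArg Complex.im h1
    simp at hre him
    refine ⟨by nlinarith, ?_⟩
    have : w.im * (2 * s 1 0 * w.re + (s 1 1 - s 0 0)) = 0 := by nlinarith
    exact (mul_eq_zero.mp this).resolve_left w.im_ne_zero
  have hcont : Tendsto (fun ε : ℝ ↦ ε +ᵥ z) (𝓝[≠] 0) (𝓝 z) := by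
    have h1 : Continuous fun ε : ℝ ↦ ε +ᵥ z := by
      rw [UpperHalfPlane.isEmbedding_coe.continuous_iff]
      simp only [Function.comp_def, UpperHalfPlane.coe_vadd]
      fun_prop
    have h2 := h1.tendsto 0
    rw [zero_vadd] at h2
    exact h2.mono_left nhdsWithin_le_nhds
  obtain ⟨ε, hε, hε0⟩ := ((hcont.eventually h).and self_mem_nhdsWithin).exists
  obtain ⟨h1, h2⟩ := hfix z h.self_of_nhds
  obtain ⟨-, h3⟩ := hfix _ hε
  rw [UpperHalfPlane.vadd_re] at h3
  have hc : s 1 0 = 0 := by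
    have : ε * s 1 0 = 0 := by linarith
    exact (mul_eq_zero.mp this).resolve_left hε0
  rw [hc] at h1 h2
  have had : s 1 1 = s 0 0 := by linarith
  rw [had, sub_self] at h1
  have hb : s 0 1 = 0 := by linarith
  refine (QuotientGroup.eq_one_iff s).mpr ?_
  rw [Matrix.SpecialLinearGroup.mem_center_iff]
  have hdet := s.det_coe
  rw [Matrix.det_fin_two, had, hb] at hdet
  refine ⟨s 0 0, by rw [Fintype.card_fin]; linarith, ?_⟩
  ext i j
  fin_cases i <;> fin_cases j <;> simp [hb, hc, had]

namespace IsFundamentalPolygon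

variable {Γ : Subgroup PSL(2, ℝ)} {F : Set ℍ} (hF : IsFundamentalPolygon Γ F)
include hF

theorem isOpen : IsOpen F := by
  obtain ⟨S, rfl⟩ := hF.polygon
  exact isOpen_biInter_finset fun g _ ↦ isOpen_openHalfPlane g

theorem nonempty : F.Nonempty := by
  obtain ⟨γ, -, h⟩ := hF.covers UpperHalfPlane.I
  exact closure_nonempty_iff.mp ⟨_, h⟩

/-- The polygon is open, so that the boundary alternative in the definition does not occur. -/
theorem smul_eq_self {γ : PSL(2, ℝ)} (hγ : γ ∈ Γ) {z : ℍ} (hz : z ∈ F) (hγz : γ • z ∈ F) :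
    γ • z = z := by
  rcases hF.equiv_boundary z (subset_closure hz) _ (subset_closure hγz) ⟨γ, hγ, rfl⟩ with h | h
  · exact h.symm
  · exact absurd hz (hF.isOpen.frontier_eq ▸ h.1).2

theorem eq_one {γ : PSL(2, ℝ)} (hγ : γ ∈ Γ) {z : ℍ} (hz : z ∈ F) (hγz : γ • z ∈ F) : γ = 1 := by
  refine eq_one_of_eventually_smul_eq (z := z) ?_
  filter_upwards [hF.isOpen.mem_nhds hz,
    (continuous_const_smul γ).continuousAt.preimage_mem_nhds (hF.isOpen.mem_nhds hγz)] with w h1 h2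
  exact hF.smul_eq_self hγ h1 h2

theorem eq_of_mem_smul {γ δ : PSL(2, ℝ)} (hγ : γ ∈ Γ) (hδ : δ ∈ Γ) {z : ℍ} (h1 : z ∈ γ • F)
    (h2 : z ∈ δ • F) : γ = δ := by
  rw [Set.mem_smul_set_iff_inv_smul_mem] at h1 h2
  have := hF.eq_one (Γ.mul_mem (Γ.inv_mem hδ) hγ) h1
    (by rwa [smul_smul, mul_assoc, mul_inv_cancel, mul_one])
  exact (inv_mul_eq_one.mp this).symm

theorem countable : Countable Γ := by
  have h : (Set.univ : Set Γ).PairwiseDisjoint fun γ ↦ (γ : PSL(2, ℝ)) • F := by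
    intro γ _ δ _ hne
    refine Set.disjoint_left.mpr fun z h1 h2 ↦ hne ?_
    exact Subtype.ext (hF.eq_of_mem_smul γ.2 δ.2 h1 h2)
  exact Set.countable_univ_iff.mp
    (h.countable_of_isOpen (fun γ _ ↦ hF.isOpen.smul _) fun γ _ ↦ hF.nonempty.smul_set)

/-- A fundamental polygon meets the `Γ`-translates of a set `D` in a set of area at most that of
`D`. -/
theorem volume_inter_le {D : Set ℍ} (hD : MeasurableSet D) :
    volume {z | z ∈ F ∧ ∃ γ ∈ Γ, γ • z ∈ D} ≤ volume D := by
  have := hF.countable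
  calc volume {z | z ∈ F ∧ ∃ γ ∈ Γ, γ • z ∈ D}
      ≤ volume (⋃ γ : Γ, (γ : PSL(2, ℝ))⁻¹ • ((γ : PSL(2, ℝ)) • F ∩ D)) := by
        refine measure_mono ?_
        rintro z ⟨hz, γ, hγ, hγz⟩
        refine Set.mem_iUnion.mpr ⟨⟨γ, hγ⟩, ?_⟩
        rw [Set.mem_smul_set_iff_inv_smul_mem, inv_inv]
        exact ⟨Set.smul_mem_smul_set hz, hγz⟩
    _ ≤ ∑' γ : Γ, volume ((γ : PSL(2, ℝ))⁻¹ • ((γ : PSL(2, ℝ)) • F ∩ D)) := measure_iUnion_le _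
    _ = ∑' γ : Γ, volume ((γ : PSL(2, ℝ)) • F ∩ D) := by simp only [measure_smul]
    _ = volume (⋃ γ : Γ, (γ : PSL(2, ℝ)) • F ∩ D) := by
        rw [measure_iUnion]
        · intro γ δ hne
          refine Set.disjoint_left.mpr fun z h1 h2 ↦ hne ?_
          exact Subtype.ext (hF.eq_of_mem_smul γ.2 δ.2 h1.1 h2.1)
        · exact fun γ ↦ ((hF.isOpen.smul _).measurableSet).inter hD
    _ ≤ volume D := measure_mono (Set.iUnion_subset fun _ ↦ Set.inter_subset_right)

theorem volume_ne_top (hcof : IsCofinite Γ) : volume F ≠ ⊤ := by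
  obtain ⟨D, hD, hDfin, hcov⟩ := hcof
  refine ne_top_of_le_ne_top hDfin.ne ((measure_mono fun z hz ↦ ?_).trans (hF.volume_inter_le hD))
  exact ⟨hz, hcov z⟩

theorem volume_pos : 0 < volume F := hF.isOpen.measure_pos volume hF.nonempty

end IsFundamentalPolygon

/-! ### Crossings over one period -/

namespace ClosedGeodesic

variable {Γ : Subgroup PSL(2, ℝ)} (c : ClosedGeodesic Γ)

theorem path_eq_flow : c.path = flow c.lift := rfl

/-- The element `g a_T g⁻¹` translating the lifted geodesic by `T`. -/
def translation (T : ℝ) : PSL(2, ℝ) := c.lift * diagElt T * c.lift⁻¹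

theorem translation_smul_path (T t : ℝ) : c.translation T • c.path t = c.path (t + T) := by
  rw [path_eq_flow, smul_flow, flow, flow, translation, inv_mul_cancel_right, add_comm,
    diagElt_add, mul_assoc]

/-- The group of periods of the geodesic flow. -/
def periods : AddSubgroup ℝ where
  carrier := {T | c.translation T ∈ Γ}
  add_mem' {s t} hs ht := by
    have : c.translation (s + t) = c.translation s * c.translation t := by
      simp [translation, diagElt_add, mul_assoc]
    rw [Set.mem_ofPred_eq, this]
    exact Γ.mul_mem hs ht
  zero_mem' := by simp [translation, diagElt_zero, Γ.one_mem]
  neg_mem' {t} ht := by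
    have : c.translation (-t) = (c.translation t)⁻¹ := by
      simp [translation, diagElt_neg, mul_assoc]
    rw [Set.mem_ofPred_eq, this]
    exact Γ.inv_mem ht

theorem length_nonneg : 0 ≤ c.length := Real.sInf_nonneg fun _ h ↦ h.1.le

/-- The infimum defining the length is attained as soon as it is positive. -/
theorem length_mem_periods (h : 0 < c.length) : c.length ∈ c.periods := by
  obtain ⟨⟨T, hT0, hT⟩, -⟩ := c.exists_lift.choose_spec
  have hbdd : BddBelow {T : ℝ | 0 < T ∧ c.lift * diagElt T * c.lift⁻¹ ∈ Γ} := ⟨0, fun _ h ↦ h.1.le⟩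
  have hbot : c.periods ≠ ⊥ := by
    intro hbot
    have : T ∈ c.periods := hT
    rw [hbot, AddSubgroup.mem_bot] at this
    exact hT0.ne' this
  have hdisj : Disjoint (c.periods : Set ℝ) (Set.Ioo 0 c.length) :=
    Set.disjoint_left.mpr fun t ht ht' ↦ not_lt.mpr (csInf_le hbdd ⟨ht'.1, ht⟩) ht'.2
  obtain ⟨b, hb⟩ := AddSubgroup.exists_isLeast_pos hbot h hdisj
  have hset : {T : ℝ | 0 < T ∧ c.lift * diagElt T * c.lift⁻¹ ∈ Γ} =
      {g | g ∈ c.periods ∧ 0 < g} := by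
    ext t
    exact and_comm
  rw [length, hset, hb.csInf_eq]
  exact hb.1.1

theorem zmultiples_length_le (h : 0 < c.length) :
    AddSubgroup.zmultiples c.length ≤ c.periods :=
  AddSubgroup.zmultiples_le_of_mem (c.length_mem_periods h)

theorem path_sub_mem_iff {γ : PSL(2, ℝ)} {E : Set ℍ} {T t : ℝ} :
    c.path (t - T) ∈ γ • E ↔ c.path t ∈ (c.translation T * γ) • E := by
  rw [mul_smul, Set.mem_smul_set_iff_inv_smul_mem (a := c.translation T)]
  have : (c.translation T)⁻¹ • c.path t = c.path (t - T) := by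
    rw [inv_smul_eq_iff, translation_smul_path, sub_add_cancel]
  rw [this]

theorem isGLB_translation {F : Set ℍ} {γ : PSL(2, ℝ)} {T e : ℝ}
    (he : IsGLB {s | c.path s ∈ γ • F} e) :
    IsGLB {s | c.path s ∈ (c.translation T * γ) • F} (e + T) := by
  constructor
  · intro s hs
    rw [Set.mem_ofPred_eq, ← path_sub_mem_iff] at hs
    linarith [he.1 hs]
  · intro b hb
    have : b - T ≤ e := by
      refine he.2 fun s hs ↦ ?_
      have : s + T ∈ {s | c.path s ∈ (c.translation T * γ) • F} := by
        rw [Set.mem_ofPred_eq, ← path_sub_mem_iff, add_sub_cancel_right]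
        exact hs
      linarith [hb this]
    linarith

/-- The time the closed geodesic spends, during one period, in a `Γ`-invariant set (given as a
subset of `ℍ`). -/
def timeIn (E : Set ℍ) : ℝ≥0∞ := volume {t | t ∈ Set.Ioc 0 c.length ∧ c.path t ∈ E}

theorem timeIn_le (E : Set ℍ) : c.timeIn E ≤ ENNReal.ofReal c.length := by
  refine (measure_mono (fun t ht ↦ ht.1 : _ ⊆ Set.Ioc 0 c.length)).trans ?_
  simp

theorem continuous_path : Continuous c.path := continuous_flow _

theorem measurableSet_path_mem_orbit {U : Set ℍ} (hU : IsOpen U) :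
    MeasurableSet {t | c.path t ∈ {z | ∃ γ ∈ Γ, γ • z ∈ U}} := by
  have : {t | c.path t ∈ {z | ∃ γ ∈ Γ, γ • z ∈ U}} = ⋃ γ ∈ Γ, {t | γ • c.path t ∈ U} := by
    ext t; simp
  rw [this]
  exact (isOpen_biUnion fun γ _ ↦ hU.preimage (c.continuous_path.const_smul γ)).measurableSet

/-- The time spent in a set, decomposed into periods. -/
theorem volume_path_mem (hpos : 0 < c.length) (γ : PSL(2, ℝ)) (E : Set ℍ) :
    volume {t | c.path t ∈ γ • E} = ∑' T : AddSubgroup.zmultiples c.length,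
      volume ({t | c.path t ∈ (c.translation T * γ) • E} ∩ Set.Ioc 0 c.length) := by
  have hfd := isAddFundamentalDomain_Ioc hpos 0
  rw [hfd.measure_eq_tsum, zero_add]
  refine tsum_congr fun T ↦ ?_
  congr 2
  ext t
  rw [Set.mem_vadd_set_iff_neg_vadd_mem, Set.mem_ofPred_eq, Set.mem_ofPred_eq,
    ← path_sub_mem_iff, AddSubgroup.vadd_def, vadd_eq_add, AddSubgroup.coe_neg, neg_add_eq_sub]

variable {F : Set ℍ} (hF : IsFundamentalPolygon Γ F)
include hF

theorem countable_crossed : Countable (c.crossed F) := by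
  have := hF.countable
  exact (Set.countable_coe_iff.mp this).mono fun γ hγ ↦ hγ.1

/-- The total time spent in the subsets `γ E` of the crossed tiles is bounded by the time spent
during one period in the `Γ`-orbit of `E`: tiles with different entry times in `[0, length)` are
inequivalent under the period, so their visits are disjoint modulo the period. -/
theorem tsum_crossed_le_timeIn {E : Set ℍ} (hE : MeasurableSet E) (hEF : E ⊆ F) :
    ∑' γ : c.crossed F, volume {t | c.path t ∈ (γ : PSL(2, ℝ)) • E} ≤
      c.timeIn {z | ∃ γ ∈ Γ, γ • z ∈ E} := by
  rcases c.length_nonneg.eq_or_lt with h0 | hpos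
  · have : IsEmpty (c.crossed F) := ⟨fun ⟨γ, _, t, _, h1, h2⟩ ↦ by linarith⟩
    simp
  have := c.countable_crossed hF
  have hmeas : ∀ γ : PSL(2, ℝ), MeasurableSet {t | c.path t ∈ γ • E} := fun γ ↦
    c.continuous_path.measurable (hE.const_smul γ)
  simp_rw [c.volume_path_mem hpos _ E]
  rw [← ENNReal.tsum_prod, ← measure_iUnion]
  · refine measure_mono (Set.iUnion_subset ?_)
    rintro ⟨γ, T⟩ t ⟨ht, ht'⟩
    refine ⟨ht', (c.translation T * γ)⁻¹, Γ.inv_mem (Γ.mul_mem ?_ γ.2.1), ?_⟩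
    · exact c.zmultiples_length_le hpos T.2
    · rwa [Set.mem_ofPred_eq, Set.mem_smul_set_iff_inv_smul_mem] at ht
  · rintro ⟨γ, T⟩ ⟨δ, S⟩ hne
    refine Set.disjoint_left.mpr ?_
    rintro t ⟨h1, -⟩ ⟨h2, -⟩
    refine hne ?_
    have hT := c.zmultiples_length_le hpos T.2
    have hS := c.zmultiples_length_le hpos S.2
    have heq := hF.eq_of_mem_smul (Γ.mul_mem hT γ.2.1) (Γ.mul_mem hS δ.2.1)
      (Set.smul_set_mono hEF h1) (Set.smul_set_mono hEF h2)
    -- Equal tiles have equal entry times, and `T`, `S` are multiples of the length.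
    obtain ⟨-, e, he, he0, hel⟩ := γ.2
    obtain ⟨-, e', he', he0', hel'⟩ := δ.2
    have h3 := c.isGLB_translation (T := T) he
    have h4 := c.isGLB_translation (T := S) he'
    rw [heq] at h3
    have h5 := h3.unique h4
    obtain ⟨k, hk⟩ := AddSubgroup.mem_zmultiples_iff.mp (sub_mem T.2 S.2)
    rw [zsmul_eq_mul] at hk
    have h6 : (k : ℝ) < 1 := by
      by_contra! hcon
      nlinarith
    have h7 : (-1 : ℝ) < k := by
      by_contra! hcon
      nlinarith
    have hk0 : k = 0 := by
      have h6' : k < 1 := by exact_mod_cast h6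
      have h7' : -1 < k := by exact_mod_cast h7
      omega
    have hTS : (T : ℝ) = S := by
      rw [hk0] at hk
      simp at hk
      linarith
    have hTS' : T = S := Subtype.ext hTS
    subst hTS'
    have : γ = δ := Subtype.ext (mul_left_cancel heq)
    rw [this]
  · rintro ⟨γ, T⟩
    exact (hmeas _).inter measurableSet_Ioc

/-- A tile is entered at a definite time: otherwise, by convexity, it would contain two points of
the geodesic that differ by a period. -/
theorem bddBelow_crossing (hpos : 0 < c.length) {γ : PSL(2, ℝ)} (hγ : γ ∈ Γ) :
    BddBelow {s | c.path s ∈ γ • F} := by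
  by_contra hcon
  rw [not_bddBelow_iff] at hcon
  obtain ⟨t, ht, -⟩ := hcon 0
  obtain ⟨s, hs, hst⟩ := hcon (t - c.length)
  have hconn : {s | c.path s ∈ γ • F}.OrdConnected := ordConnected_flow_mem hF.polygon _ _
  have h1 : c.path (t - c.length) ∈ γ • F := hconn.out hs ht ⟨hst.le, by linarith⟩
  rw [path_sub_mem_iff] at h1
  have h2 := hF.eq_of_mem_smul (Γ.mul_mem (c.length_mem_periods hpos) hγ) hγ h1 ht
  have h3 := c.translation_smul_path c.length 0
  rw [mul_eq_right.mp h2, one_smul] at h3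
  have h4 := dist_flow c.lift 0 (0 + c.length)
  rw [← path_eq_flow, ← h3, dist_self] at h4
  rw [zero_add, zero_sub, abs_neg, abs_of_pos hpos] at h4
  exact hpos.ne h4

/-- The time spent during one period in the `Γ`-orbit of `E` is bounded by the total time spent in
the subsets `γ E` of the crossed tiles: each visited tile is the translate by a multiple of the
period of a tile entered in `[0, length)`. -/
theorem timeIn_le_tsum_crossed {E : Set ℍ} (hEF : E ⊆ F) :
    c.timeIn {z | ∃ γ ∈ Γ, γ • z ∈ E} ≤
      ∑' γ : c.crossed F, volume {t | c.path t ∈ (γ : PSL(2, ℝ)) • E} := by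
  rcases c.length_nonneg.eq_or_lt with h0 | hpos
  · simp [timeIn, ← h0]
  have := c.countable_crossed hF
  simp_rw [c.volume_path_mem hpos _ E]
  rw [← ENNReal.tsum_prod]
  refine (measure_mono ?_).trans (measure_iUnion_le _)
  rintro t ⟨ht, γ, hγ, htγ⟩
  have htE : c.path t ∈ γ⁻¹ • E := by rwa [Set.mem_smul_set_iff_inv_smul_mem, inv_inv]
  have hglb := isGLB_csInf (s := {s | c.path s ∈ γ⁻¹ • F}) ⟨t, Set.smul_set_mono hEF htE⟩
    (c.bddBelow_crossing hF hpos (Γ.inv_mem hγ))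
  set e := sInf {s | c.path s ∈ γ⁻¹ • F}
  obtain ⟨k, hk, -⟩ := existsUnique_sub_zsmul_mem_Ico hpos e 0
  have hkm : k • c.length ∈ AddSubgroup.zmultiples c.length := ⟨k, rfl⟩
  have hnm : -(k • c.length) ∈ c.periods := c.zmultiples_length_le hpos (neg_mem hkm)
  have hcr : c.translation (-(k • c.length)) * γ⁻¹ ∈ c.crossed F := by
    refine ⟨Γ.mul_mem hnm (Γ.inv_mem hγ), _, c.isGLB_translation hglb, ?_, ?_⟩
    · have := hk.1; rw [← sub_eq_add_neg]; exact this
    · have := hk.2; rw [← sub_eq_add_neg]; rwa [zero_add] at this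
  refine Set.mem_iUnion.mpr ⟨(⟨_, hcr⟩, ⟨_, hkm⟩), ?_, ht⟩
  have h1 : c.translation (k • c.length) * c.translation (-(k • c.length)) = 1 := by
    simp [translation, diagElt_neg, mul_assoc]
  rw [Set.mem_ofPred_eq, ← mul_assoc, h1, one_mul]
  exact htE

end ClosedGeodesic

/-! ### Consequences of equidistribution -/

theorem coe_unipElt_mul_diagElt_mul_rotElt_smul_I (x s θ : ℝ) :
    (((unipElt x * diagElt s * rotElt θ) • UpperHalfPlane.I : ℍ) : ℂ) =
      x + Real.exp s * Complex.I := by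
  rw [mul_smul, rotElt_smul_I, mul_smul]
  apply Complex.ext
  · rw [UpperHalfPlane.coe_re, unipElt_smul_re, diagElt_smul_re]
    simp [-Complex.ofReal_exp]
  · rw [UpperHalfPlane.coe_im, unipElt_smul_im, diagElt_smul_im]
    simp [-Complex.ofReal_exp]

open Classical in
/-- The `Γ`-invariant function on `ℍ` that agrees with `f` on the fundamental polygon `F`, extended
by zero outside the translates of `F`. -/
def periodize (Γ : Subgroup PSL(2, ℝ)) (F : Set ℍ) (f : ℂ → ℝ) (z : ℍ) : ℝ :=
  if h : ∃ γ ∈ Γ, γ • z ∈ F then f (h.choose • z : ℍ) else 0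

namespace IsFundamentalPolygon

variable {Γ : Subgroup PSL(2, ℝ)} {F : Set ℍ} (hF : IsFundamentalPolygon Γ F)
include hF

theorem periodize_eq {f : ℂ → ℝ} {γ : PSL(2, ℝ)} (hγ : γ ∈ Γ) {z : ℍ} (hz : γ • z ∈ F) :
    periodize Γ F f z = f (γ • z : ℍ) := by
  have h : ∃ γ ∈ Γ, γ • z ∈ F := ⟨γ, hγ, hz⟩
  rw [periodize, dif_pos h]
  have h1 := h.choose_spec
  have h2 : h.choose⁻¹ = γ⁻¹ := by
    refine hF.eq_of_mem_smul (z := z) (Γ.inv_mem h1.1) (Γ.inv_mem hγ) ?_ ?_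
    · rw [Set.mem_smul_set_iff_inv_smul_mem, inv_inv]; exact h1.2
    · rw [Set.mem_smul_set_iff_inv_smul_mem, inv_inv]; exact hz
  rw [inv_injective h2]

theorem periodize_smul (f : ℂ → ℝ) {γ : PSL(2, ℝ)} (hγ : γ ∈ Γ) (z : ℍ) :
    periodize Γ F f (γ • z) = periodize Γ F f z := by
  by_cases h : ∃ δ ∈ Γ, δ • z ∈ F
  · obtain ⟨δ, hδ, hδz⟩ := h
    rw [hF.periodize_eq hδ hδz, hF.periodize_eq (γ := δ * γ⁻¹) (Γ.mul_mem hδ (Γ.inv_mem hγ))]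
    · rw [smul_smul, inv_mul_cancel_right]
    · rwa [smul_smul, inv_mul_cancel_right]
  · have h' : ¬ ∃ δ ∈ Γ, δ • γ • z ∈ F := by
      rintro ⟨δ, hδ, hδz⟩
      exact h ⟨δ * γ, Γ.mul_mem hδ hγ, by rwa [mul_smul]⟩
    rw [periodize, dif_neg h', periodize, dif_neg h]

theorem exists_mem_of_periodize_ne_zero {f : ℂ → ℝ} {L : Set ℍ}
    (hf : ∀ z : ℍ, f z ≠ 0 → z ∈ L) {z : ℍ} (hz : periodize Γ F f z ≠ 0) :
    ∃ γ ∈ Γ, γ • z ∈ L := by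
  by_cases h : ∃ δ ∈ Γ, δ • z ∈ F
  · obtain ⟨δ, hδ, hδz⟩ := h
    rw [hF.periodize_eq hδ hδz] at hz
    exact ⟨δ, hδ, hf _ hz⟩
  · rw [periodize, dif_neg h] at hz
    exact absurd rfl hz

/-- Periodizing a smooth function with compact support in the open polygon `F` gives a smooth
function: the translates of its support stay at a positive distance from the points that have no
translate in `F`. -/
theorem isSmooth_periodize {f : ℂ → ℝ} (hsm : ContDiff ℝ ((⊤ : ℕ∞) : WithTop ℕ∞) f) {L : Set ℍ}
    (hL : IsCompact L) (hLF : L ⊆ F) (hf : ∀ z : ℍ, f z ≠ 0 → z ∈ L) :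
    IsSmooth fun g ↦ (periodize Γ F f (g • UpperHalfPlane.I) : ℂ) := by
  obtain ⟨δ, hδ, hδF⟩ := hL.exists_thickening_subset_open hF.isOpen hLF
  set ι : ℝ × ℝ × ℝ → ℍ := fun p ↦ (unipElt p.1 * diagElt p.2.1 * rotElt p.2.2) • UpperHalfPlane.I
    with hι
  have hcoe : ∀ p, ((ι p : ℍ) : ℂ) = p.1 + Real.exp p.2.1 * Complex.I := fun p ↦
    coe_unipElt_mul_diagElt_mul_rotElt_smul_I _ _ _
  have hιsm : ContDiff ℝ ((⊤ : ℕ∞) : WithTop ℕ∞) fun p ↦ ((ι p : ℍ) : ℂ) := by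
    simp only [hcoe]
    have h1 : ContDiff ℝ ((⊤ : ℕ∞) : WithTop ℕ∞) fun p : ℝ × ℝ × ℝ ↦ (p.1 : ℂ) :=
      Complex.ofRealCLM.contDiff.comp contDiff_fst
    have h2 : ContDiff ℝ ((⊤ : ℕ∞) : WithTop ℕ∞) fun p : ℝ × ℝ × ℝ ↦ (Real.exp p.2.1 : ℂ) :=
      Complex.ofRealCLM.contDiff.comp (Real.contDiff_exp.comp (contDiff_fst.comp contDiff_snd))
    exact h1.add (h2.mul contDiff_const)
  have hιc : Continuous ι := UpperHalfPlane.isEmbedding_coe.continuous_iff.mpr hιsm.continuous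
  refine contDiff_iff_contDiffAt.mpr fun p ↦ ?_
  change ContDiffAt ℝ _ (fun p ↦ (periodize Γ F f (ι p) : ℂ)) p
  refine Complex.ofRealCLM.contDiff.contDiffAt.comp p ?_
  by_cases h : ∃ γ ∈ Γ, γ • ι p ∈ F
  · obtain ⟨γ, hγ, hγp⟩ := h
    obtain ⟨s, rfl⟩ := toPSL_surjective γ
    have hev : (fun p ↦ periodize Γ F f (ι p)) =ᶠ[𝓝 p]
        fun p ↦ f (((s 0 0 : ℂ) * ι p + s 0 1) / ((s 1 0 : ℂ) * ι p + s 1 1)) := by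
      have : Continuous fun p ↦ toPSL s • ι p := (continuous_const_smul (toPSL s)).comp hιc
      filter_upwards [this.continuousAt.preimage_mem_nhds (hF.isOpen.mem_nhds hγp)] with q hq
      rw [hF.periodize_eq hγ hq, coe_toPSL_smul]
    refine ContDiffAt.congr_of_eventuallyEq ?_ hev
    simp only [div_eq_mul_inv]
    refine hsm.contDiffAt.comp p (ContDiffAt.mul ?_ (ContDiffAt.inv ?_ ?_))
    · exact (contDiffAt_const.mul hιsm.contDiffAt).add contDiffAt_const
    · exact (contDiffAt_const.mul hιsm.contDiffAt).add contDiffAt_const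
    · intro h0
      have h1 := coe_toPSL_smul s (ι p)
      rw [h0, div_zero] at h1
      exact (toPSL s • ι p).ne_zero h1
  · have hev : (fun p ↦ periodize Γ F f (ι p)) =ᶠ[𝓝 p] fun _ ↦ 0 := by
      filter_upwards [hιc.continuousAt.preimage_mem_nhds (Metric.ball_mem_nhds (ι p) hδ)] with q hq
      by_contra hne
      obtain ⟨γ, hγ, hγq⟩ := hF.exists_mem_of_periodize_ne_zero hf hne
      refine h ⟨γ, hγ, hδF (Metric.mem_thickening_iff.mpr ⟨_, hγq, ?_⟩)⟩
      rw [dist_smul, dist_comm]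
      exact hq
    exact contDiffAt_const.congr_of_eventuallyEq hev

theorem unitTangentIntegral_periodize (f : ℂ → ℝ) :
    unitTangentIntegral F (fun g ↦ (periodize Γ F f (g • UpperHalfPlane.I) : ℂ)) =
      ((∫ z in F, f (z : ℍ) : ℝ) : ℂ) := by
  rw [unitTangentIntegral, ← integral_complex_ofReal]
  refine setIntegral_congr_fun hF.isOpen.measurableSet fun z hz ↦ ?_
  have h1 : ∀ θ, (unipElt z.re * diagElt (Real.log z.im) * rotElt θ) • UpperHalfPlane.I = z := by
    intro θ
    apply UpperHalfPlane.ext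
    rw [coe_unipElt_mul_diagElt_mul_rotElt_smul_I, Real.exp_log z.im_pos]
    exact Complex.re_add_im (z : ℂ)
  have h2 := hF.periodize_eq (f := f) Γ.one_mem (z := z) (by rwa [one_smul])
  rw [one_smul] at h2
  simp only [h1, h2, intervalIntegral.integral_const, sub_zero]
  rw [Complex.real_smul, ← mul_assoc, ← Complex.ofReal_mul, inv_mul_cancel₀ Real.pi_ne_zero]
  simp

theorem exists_isCompact_of_periodize_ne_zero {f : ℂ → ℝ} {L : Set ℍ} (hL : IsCompact L)
    (hf : ∀ z : ℍ, f z ≠ 0 → z ∈ L) :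
    ∃ K : Set PSL(2, ℝ), IsCompact K ∧
      ∀ g : PSL(2, ℝ), (periodize Γ F f (g • UpperHalfPlane.I) : ℂ) ≠ 0 → ∃ γ ∈ Γ, γ * g ∈ K := by
  refine ⟨toPSL '' ((fun g : SL(2, ℝ) ↦ g • UpperHalfPlane.I) ⁻¹' L),
    (UpperHalfPlane.isProperMap_smul_I.isCompact_preimage hL).image continuous_quot_mk,
    fun g hg ↦ ?_⟩
  obtain ⟨γ, hγ, hγg⟩ := hF.exists_mem_of_periodize_ne_zero hf (Complex.ofReal_ne_zero.mp hg)
  refine ⟨γ, hγ, ?_⟩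
  obtain ⟨s, hs⟩ := toPSL_surjective (γ * g)
  refine ⟨s, ?_, hs⟩
  rw [Set.mem_preimage, ← toPSL_smul, hs, mul_smul]
  exact hγg

end IsFundamentalPolygon

/-- A smooth bump function between `K` and `U`, defined on all of `ℂ`. -/
theorem exists_smooth_bump {K U : Set ℍ} (hK : IsCompact K) (hU : IsOpen U) (hKU : K ⊆ U) :
    ∃ (f : ℂ → ℝ) (L : Set ℍ), ContDiff ℝ ((⊤ : ℕ∞) : WithTop ℕ∞) f ∧ (∀ z, 0 ≤ f z) ∧
      (∀ z, f z ≤ 1) ∧ (∀ z ∈ K, f (z : ℍ) = 1) ∧ IsCompact L ∧ L ⊆ U ∧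
      ∀ z : ℍ, f z ≠ 0 → z ∈ L := by
  obtain ⟨L, hL, hKL, hLU⟩ := exists_compact_between hK hU hKU
  have h1 : IsClosed (UpperHalfPlane.coe '' interior L)ᶜ :=
    (UpperHalfPlane.isOpenEmbedding_coe.isOpenMap _ isOpen_interior).isClosed_compl
  have h2 : IsClosed (UpperHalfPlane.coe '' K) := (hK.image UpperHalfPlane.continuous_coe).isClosed
  obtain ⟨f, hf, hfr, hf0, hf1⟩ := exists_contMDiff_zero_iff_one_iff_of_isClosed (n := ⊤)
    (modelWithCornersSelf ℝ ℂ) h1 h2 (by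
      rw [Set.disjoint_compl_left_iff_subset]
      exact Set.image_mono hKL)
  refine ⟨f, L, hf.contDiff, fun z ↦ (hfr ⟨z, rfl⟩).1, fun z ↦ (hfr ⟨z, rfl⟩).2,
    fun z hz ↦ (hf1 _).mp ⟨z, hz, rfl⟩, hL, hLU, fun z hz ↦ ?_⟩
  by_contra hcon
  refine hz ((hf0 _).mp ?_)
  rintro ⟨w, hw, hwz⟩
  rw [UpperHalfPlane.ext hwz] at hw
  exact hcon (interior_subset hw)

theorem totalLength_nonneg {Γ : Subgroup PSL(2, ℝ)} (C : Multiset (ClosedGeodesic Γ)) :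
    0 ≤ totalLength C := by
  refine Multiset.sum_nonneg fun x hx ↦ ?_
  obtain ⟨c, -, rfl⟩ := Multiset.mem_map.mp hx
  exact c.length_nonneg

theorem ofReal_integral_le_lintegral {α : Type*} [MeasurableSpace α] (μ : Measure α) {f : α → ℝ}
    (hf : ∀ x, 0 ≤ f x) : ENNReal.ofReal (∫ x, f x ∂μ) ≤ ∫⁻ x, ENNReal.ofReal (f x) ∂μ := by
  by_cases h : Integrable f μ
  · rw [ofReal_integral_eq_lintegral_ofReal h (ae_of_all _ hf)]
  · simp [integral_undef h]

/-- Equidistribution bounds from below the time spent in (the orbit of) an open subset of the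
fundamental polygon. -/
theorem eventually_le_sum_timeIn {Γ : Subgroup PSL(2, ℝ)} {F : Set ℍ}
    (hF : IsFundamentalPolygon Γ F) (hfin : volume F ≠ ⊤) {C : ℕ → Multiset (ClosedGeodesic Γ)}
    (hC : Equidistributes Γ F C) {K U : Set ℍ} (hK : IsCompact K) (hU : IsOpen U) (hKU : K ⊆ U)
    (hUF : U ⊆ F) {η : ℝ} (hη : η < volume.real K / volume.real F) :
    ∀ᶠ n in atTop, ENNReal.ofReal (η * totalLength (C n)) ≤
      ((C n).map fun c ↦ c.timeIn {z | ∃ γ ∈ Γ, γ • z ∈ U}).sum := by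
  obtain ⟨f, L, hsm, hf0, hf1, hfK, hL, hLU, hfL⟩ := exists_smooth_bump hK hU hKU
  set Ψ : PSL(2, ℝ) → ℂ := fun g ↦ (periodize Γ F f (g • UpperHalfPlane.I) : ℂ) with hΨ
  have hlim := hC Ψ (fun γ hγ g ↦ by simp only [hΨ, mul_smul, hF.periodize_smul f hγ])
    (hF.isSmooth_periodize hsm hL (hLU.trans hUF) hfL)
    (hF.exists_isCompact_of_periodize_ne_zero hL hfL)
  have hp0 : ∀ z, 0 ≤ periodize Γ F f z := by
    intro z
    rw [periodize]
    split_ifs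
    · exact hf0 _
    · exact le_rfl
  have hp1 : ∀ z, periodize Γ F f z ≤ 1 := by
    intro z
    rw [periodize]
    split_ifs
    · exact hf1 _
    · exact zero_le_one
  -- The averages and their limit are real.
  set J : ClosedGeodesic Γ → ℝ := fun c ↦ ∫ t in (0 : ℝ)..c.length, periodize Γ F f (c.path t)
    with hJ
  have hint : ∀ c : ClosedGeodesic Γ, c.integral Ψ = (J c : ℂ) := fun c ↦ by
    rw [ClosedGeodesic.integral, hJ, ← intervalIntegral.integral_ofReal]
    rfl
  have hsum : ∀ n, ((C n).map fun c ↦ c.integral Ψ).sum / (totalLength (C n) : ℂ) =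
      ((((C n).map J).sum / totalLength (C n) : ℝ) : ℂ) := by
    intro n
    simp only [hint]
    rw [Complex.ofReal_div]
    congr 1
    rw [← Complex.ofRealHom_eq_coe, map_multiset_sum, Multiset.map_map]
    rfl
  simp only [hsum] at hlim
  rw [hF.unitTangentIntegral_periodize, ← Complex.ofReal_div] at hlim
  have hlim' := (Complex.continuous_re.tendsto _).comp hlim
  simp only [Function.comp_def, Complex.ofReal_re] at hlim'
  have hFpos : 0 < volume.real F := ENNReal.toReal_pos hF.volume_pos.ne' hfin
  have hmain : volume.real K ≤ ∫ z in F, f (z : ℍ) := by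
    have hm : Measurable fun z : ℍ ↦ f z :=
      hsm.continuous.measurable.comp UpperHalfPlane.measurable_coe
    have hif : IntegrableOn (fun z : ℍ ↦ f z) F := by
      have : IsFiniteMeasure (volume.restrict F) := ⟨by
        rw [Measure.restrict_apply_univ]; exact hfin.lt_top⟩
      refine Integrable.of_bound hm.aestronglyMeasurable 1 (ae_of_all _ fun z ↦ ?_)
      rw [Real.norm_eq_abs, abs_of_nonneg (hf0 _)]
      exact hf1 _
    calc volume.real K = ∫ z in K, f (z : ℍ) := by
          rw [setIntegral_congr_fun hK.measurableSet fun z hz ↦ hfK z hz]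
          simp
      _ ≤ ∫ z in F, f (z : ℍ) :=
          setIntegral_mono_set hif (ae_of_all _ fun z ↦ hf0 _)
            (LE.le.eventuallyLE (hKU.trans hUF))
  have hev := hlim'.eventually_const_lt (hη.trans_le (by gcongr))
  filter_upwards [hev] with n hn
  have hJle : ∀ c : ClosedGeodesic Γ,
      ENNReal.ofReal (J c) ≤ c.timeIn {z | ∃ γ ∈ Γ, γ • z ∈ U} := by
    intro c
    rw [hJ]
    simp only
    rw [intervalIntegral.integral_of_le c.length_nonneg]
    refine (ofReal_integral_le_lintegral _ fun t ↦ hp0 _).trans ?_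
    have hUm := c.measurableSet_path_mem_orbit hU
    have : c.timeIn {z | ∃ γ ∈ Γ, γ • z ∈ U} = ∫⁻ t in Set.Ioc 0 c.length,
        {t | c.path t ∈ {z : ℍ | ∃ γ ∈ Γ, γ • z ∈ U}}.indicator 1 t := by
      rw [lintegral_indicator_one hUm, Measure.restrict_apply hUm, ClosedGeodesic.timeIn]
      congr 1
      ext t
      exact and_comm
    rw [this]
    refine lintegral_mono fun t ↦ ?_
    by_cases ht : periodize Γ F f (c.path t) = 0
    · simp [ht]
    · obtain ⟨γ, hγ, hγt⟩ := hF.exists_mem_of_periodize_ne_zero hfL ht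
      have hmem : t ∈ {t | c.path t ∈ {z : ℍ | ∃ γ ∈ Γ, γ • z ∈ U}} := ⟨γ, hγ, hLU hγt⟩
      rw [Set.indicator_of_mem hmem, Pi.one_apply, ENNReal.ofReal_le_one]
      exact hp1 _
  have hJsum : ENNReal.ofReal ((C n).map J).sum ≤
      ((C n).map fun c ↦ c.timeIn {z | ∃ γ ∈ Γ, γ • z ∈ U}).sum := by
    refine (Multiset.le_sum_of_subadditive ENNReal.ofReal ENNReal.ofReal_zero.le
      (fun _ _ ↦ ENNReal.ofReal_add_le) _).trans ?_
    rw [Multiset.map_map]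
    exact Multiset.sum_map_le_sum_map _ _ fun c _ ↦ hJle c
  refine le_trans (ENNReal.ofReal_le_ofReal ?_) hJsum
  rcases (totalLength_nonneg (C n)).eq_or_lt with h0 | hpos
  · rw [← h0, mul_zero]
    refine Multiset.sum_nonneg fun x hx ↦ ?_
    obtain ⟨c, -, rfl⟩ := Multiset.mem_map.mp hx
    exact intervalIntegral.integral_nonneg c.length_nonneg fun t _ ↦ hp0 _
  · exact ((lt_div_iff₀ hpos).mp hn).le

/-! ### The volume of a partial covering as a sum over the crossed tiles -/

namespace ClosedGeodesic

variable {Γ : Subgroup PSL(2, ℝ)} (c : ClosedGeodesic Γ)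

/-- The volume above `B ⊆ F` of the partial covering of one closed geodesic: the crossed tiles are
moved back to `F`, and the areas of the parts of `B` to the left of the geodesic are added up. -/
def coveringArea (F B : Set ℍ) : ℝ≥0∞ :=
  ∑' γ : c.crossed F, volume {z | (γ : PSL(2, ℝ)) • z ∈ c.leftSide ∧ z ∈ B}

theorem isClosed_leftSide : IsClosed c.leftSide :=
  isClosed_Iic.preimage (UpperHalfPlane.continuous_re.comp (continuous_const_smul _))

theorem measurableSet_smul_mem_leftSide (γ : PSL(2, ℝ)) :
    MeasurableSet {z | γ • z ∈ c.leftSide} :=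
  (c.isClosed_leftSide.preimage (continuous_const_smul γ)).measurableSet

variable {F : Set ℍ} (hF : IsFundamentalPolygon Γ F)
include hF

theorem partialCovering_eq {z : ℍ} (hz : z ∈ F) :
    partialCovering F c z =
      ∑' γ : c.crossed F, {z | (γ : PSL(2, ℝ)) • z ∈ c.leftSide}.indicator 1 z := by
  refine tsum_congr fun γ ↦ ?_
  have hset : {w | ∃ δ ∈ Γ, δ • z = w} ∩ (c.leftSide ∩ (γ : PSL(2, ℝ)) • F) =
      {(γ : PSL(2, ℝ)) • z} ∩ c.leftSide := by
    ext w
    constructor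
    · rintro ⟨⟨δ, hδ, rfl⟩, h1, h2⟩
      refine ⟨?_, h1⟩
      rw [Set.mem_smul_set_iff_inv_smul_mem, smul_smul] at h2
      have := hF.eq_one (Γ.mul_mem (Γ.inv_mem γ.2.1) hδ) hz h2
      rw [inv_mul_eq_one.mp this]
      rfl
    · rintro ⟨rfl, h1⟩
      exact ⟨⟨γ, γ.2.1, rfl⟩, h1, Set.smul_mem_smul_set hz⟩
  rw [coverCount, hset]
  by_cases h : (γ : PSL(2, ℝ)) • z ∈ c.leftSide
  · rw [Set.indicator_of_mem (by exact h), Set.inter_eq_left.mpr (Set.singleton_subset_iff.mpr h)]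
    simp
  · rw [Set.indicator_of_notMem (by exact h), Set.singleton_inter_eq_empty.mpr h]
    simp

theorem measurable_sum_indicator :
    Measurable fun z ↦
      ∑' γ : c.crossed F, {z | (γ : PSL(2, ℝ)) • z ∈ c.leftSide}.indicator (1 : ℍ → ℝ≥0∞) z := by
  have := c.countable_crossed hF
  exact Measurable.tsum fun γ ↦
    measurable_one.indicator (c.measurableSet_smul_mem_leftSide _)

theorem lintegral_sum_indicator (B : Set ℍ) :
    ∫⁻ z in B, ∑' γ : c.crossed F,
      {z | (γ : PSL(2, ℝ)) • z ∈ c.leftSide}.indicator (1 : ℍ → ℝ≥0∞) z = c.coveringArea F B := by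
  have := c.countable_crossed hF
  rw [lintegral_tsum fun γ ↦
    (measurable_one.indicator (c.measurableSet_smul_mem_leftSide _)).aemeasurable]
  refine tsum_congr fun γ ↦ ?_
  rw [lintegral_indicator_one (c.measurableSet_smul_mem_leftSide _),
    Measure.restrict_apply (c.measurableSet_smul_mem_leftSide _)]
  rfl

end ClosedGeodesic

theorem coveringVolume_eq {Γ : Subgroup PSL(2, ℝ)} {F : Set ℍ} (hF : IsFundamentalPolygon Γ F)
    (C : Multiset (ClosedGeodesic Γ)) {B : Set ℍ} (hB : MeasurableSet B) (hBF : B ⊆ F) :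
    coveringVolume F C B = (C.map fun c ↦ c.coveringArea F B).sum := by
  have h1 : coveringVolume F C B = ∫⁻ z in B, (C.map fun c : ClosedGeodesic Γ ↦
      ∑' γ : c.crossed F, {z | (γ : PSL(2, ℝ)) • z ∈ c.leftSide}.indicator 1 z).sum := by
    refine setLIntegral_congr_fun hB fun z hz ↦ ?_
    simp only [partialCoveringSum]
    congr 1
    exact Multiset.map_congr rfl fun c _ ↦ c.partialCovering_eq hF (hBF hz)
  rw [h1]
  clear h1
  induction C using Multiset.induction with
  | empty => simp
  | cons c C ih =>
    simp only [Multiset.map_cons, Multiset.sum_cons]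
    rw [lintegral_add_left (c.measurable_sum_indicator hF), c.lintegral_sum_indicator hF, ih]

/-! ### The covering volume dominates the total length -/

/-- Each visit of a closed geodesic to a small ball inside a tile lasts a bounded time, and the
half-plane to its left then meets the tile in a definite area. -/
theorem exists_timeIn_ball_le {Γ : Subgroup PSL(2, ℝ)} {F : Set ℍ}
    (hF : IsFundamentalPolygon Γ F) {z₀ : ℍ} {r : ℝ} (hr : 0 < r) (hball : Metric.ball z₀ r ⊆ F) :
    ∃ A : ℝ≥0∞, A ≠ ⊤ ∧ ∀ c : ClosedGeodesic Γ,
      c.timeIn {z | ∃ γ ∈ Γ, γ • z ∈ Metric.ball z₀ (r / 2)} ≤ A * c.coveringArea F F := by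
  -- By homogeneity, a half-disc at `i` measures the area cut off near any point of the geodesic.
  set D : Set ℍ := {w | w.re ≤ 0} ∩ Metric.ball UpperHalfPlane.I (r / 2) with hD
  have hDpos : volume D ≠ 0 := by
    have hopen : IsOpen ({w : ℍ | w.re < 0} ∩ Metric.ball UpperHalfPlane.I (r / 2)) :=
      (isOpen_lt UpperHalfPlane.continuous_re continuous_const).inter Metric.isOpen_ball
    have hne : ({w : ℍ | w.re < 0} ∩ Metric.ball UpperHalfPlane.I (r / 2)).Nonempty := by
      refine ⟨⟨⟨-(r / 4), 1⟩, one_pos⟩, ?_, ?_⟩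
      · change -(r / 4) < 0
        linarith
      · rw [Metric.mem_ball]
        refine (UpperHalfPlane.dist_le_dist_coe_div_sqrt _ _).trans_lt ?_
        have h1 : dist (⟨-(r / 4), 1⟩ : ℂ) Complex.I = r / 4 := by
          rw [Complex.dist_of_im_eq (by simp), Real.dist_eq]
          simp only [sub_zero, Complex.I_re, abs_neg]
          exact abs_of_pos (by positivity)
        have h2 : UpperHalfPlane.im ⟨⟨-(r / 4), 1⟩, one_pos⟩ = 1 := rfl
        rw [h2, UpperHalfPlane.coe_I, UpperHalfPlane.I_im]
        simp only [h1, mul_one, Real.sqrt_one, div_one]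
        linarith
    refine fun h ↦ (hopen.measure_pos volume hne).ne' (measure_mono_null ?_ h)
    exact Set.inter_subset_inter_left _ fun w (hw : w.re < 0) ↦ hw.le
  refine ⟨ENNReal.ofReal (2 * r) / volume D, ENNReal.div_ne_top ENNReal.ofReal_ne_top hDpos,
    fun c ↦ ?_⟩
  refine (c.timeIn_le_tsum_crossed hF
    ((Metric.ball_subset_ball (by linarith)).trans hball)).trans ?_
  rw [ClosedGeodesic.coveringArea, ← ENNReal.tsum_mul_left]
  refine ENNReal.tsum_le_tsum fun γ ↦ ?_
  rcases Set.eq_empty_or_nonempty {t | c.path t ∈ (γ : PSL(2, ℝ)) • Metric.ball z₀ (r / 2)} with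
    h | ⟨t₀, ht₀⟩
  · rw [h, measure_empty]
    exact zero_le
  have htime : volume {t | c.path t ∈ (γ : PSL(2, ℝ)) • Metric.ball z₀ (r / 2)} ≤
      ENNReal.ofReal (2 * r) := by
    have hsub : {t | c.path t ∈ (γ : PSL(2, ℝ)) • Metric.ball z₀ (r / 2)} ⊆
        Metric.closedBall t₀ r := by
      intro t ht
      rw [Set.mem_ofPred_eq, Metric.smul_ball, Metric.mem_ball] at ht ht₀
      rw [Metric.mem_closedBall, Real.dist_eq, ← dist_flow c.lift]
      have := dist_triangle_right (c.path t) (c.path t₀) ((γ : PSL(2, ℝ)) • z₀)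
      rw [ClosedGeodesic.path_eq_flow] at *
      linarith
    refine (measure_mono hsub).trans ?_
    rw [Real.volume_closedBall]
  have harea : volume D ≤ volume {z | (γ : PSL(2, ℝ)) • z ∈ c.leftSide ∧ z ∈ F} := by
    rw [← measure_smul volume ((γ : PSL(2, ℝ))⁻¹ * (c.lift * diagElt t₀)) D]
    refine measure_mono ?_
    rintro _ ⟨w, ⟨hw1, hw2⟩, rfl⟩
    refine ⟨?_, hball ?_⟩
    · simp only [smul_smul, mul_inv_cancel_left, ClosedGeodesic.leftSide, Set.mem_ofPred_eq,
        inv_mul_cancel_left, diagElt_smul_re]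
      exact mul_nonpos_of_nonneg_of_nonpos (Real.exp_pos _).le hw1
    · rw [Set.mem_ofPred_eq, Set.mem_smul_set_iff_inv_smul_mem, Metric.mem_ball] at ht₀
      rw [Metric.mem_ball] at hw2 ⊢
      have h1 : (γ : PSL(2, ℝ))⁻¹ • c.path t₀ =
          ((γ : PSL(2, ℝ))⁻¹ * (c.lift * diagElt t₀)) • UpperHalfPlane.I := by
        rw [mul_smul]; rfl
      rw [h1] at ht₀
      have h2 := dist_triangle (((γ : PSL(2, ℝ))⁻¹ * (c.lift * diagElt t₀)) • w)
        (((γ : PSL(2, ℝ))⁻¹ * (c.lift * diagElt t₀)) • UpperHalfPlane.I) z₀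
      rw [dist_smul] at h2
      simp only
      linarith
  have hDtop : volume D ≠ ⊤ :=
    ((measure_mono Set.inter_subset_right).trans_lt measure_ball_lt_top).ne
  calc volume {t | c.path t ∈ (γ : PSL(2, ℝ)) • Metric.ball z₀ (r / 2)}
      ≤ ENNReal.ofReal (2 * r) := htime
    _ = ENNReal.ofReal (2 * r) / volume D * volume D := (ENNReal.div_mul_cancel hDpos hDtop).symm
    _ ≤ _ := mul_le_mul_right harea _

theorem ofReal_totalLength {Γ : Subgroup PSL(2, ℝ)} (C : Multiset (ClosedGeodesic Γ)) :
    ENNReal.ofReal (totalLength C) = (C.map fun c ↦ ENNReal.ofReal c.length).sum := by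
  induction C using Multiset.induction with
  | empty => simp [totalLength]
  | cons c C ih =>
    have h := totalLength_nonneg C
    rw [Multiset.map_cons, Multiset.sum_cons, ← ih, ← ENNReal.ofReal_add c.length_nonneg h]
    simp [totalLength]

/-- For equidistributing collections, the volume of the partial covering grows at least linearly in
the total length. -/
theorem exists_totalLength_le {Γ : Subgroup PSL(2, ℝ)} {F : Set ℍ}
    (hF : IsFundamentalPolygon Γ F) (hfin : volume F ≠ ⊤) :
    ∃ A : ℝ, 0 < A ∧ ∀ C : ℕ → Multiset (ClosedGeodesic Γ), Equidistributes Γ F C →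
      ∀ᶠ n in atTop, ENNReal.ofReal (totalLength (C n)) ≤
        ENNReal.ofReal A * coveringVolume F (C n) F := by
  obtain ⟨z₀, hz₀⟩ := hF.nonempty
  obtain ⟨r, hr, hball⟩ := Metric.isOpen_iff.mp hF.isOpen z₀ hz₀
  obtain ⟨A, hA, hAc⟩ := exists_timeIn_ball_le hF hr hball
  have hFpos : 0 < volume.real F := ENNReal.toReal_pos hF.volume_pos.ne' hfin
  have hKpos : 0 < volume.real (Metric.closedBall z₀ (r / 4)) :=
    ENNReal.toReal_pos (Metric.measure_closedBall_pos volume z₀ (by positivity)).ne'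
      measure_closedBall_lt_top.ne
  set η := volume.real (Metric.closedBall z₀ (r / 4)) / volume.real F / 2 with hη
  have hηpos : 0 < η := by positivity
  refine ⟨η⁻¹ * (A.toReal + 1), by positivity, fun C hC ↦ ?_⟩
  filter_upwards [eventually_le_sum_timeIn hF hfin hC (isCompact_closedBall z₀ (r / 4))
    (Metric.isOpen_ball (x := z₀) (ε := r / 2)) (Metric.closedBall_subset_ball (by linarith))
    ((Metric.ball_subset_ball (by linarith)).trans hball) (η := η) (half_lt_self (by positivity))]
    with n hn
  have h1 : ((C n).map fun c ↦ c.timeIn {z | ∃ γ ∈ Γ, γ • z ∈ Metric.ball z₀ (r / 2)}).sum ≤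
      A * coveringVolume F (C n) F := by
    rw [coveringVolume_eq hF _ hF.isOpen.measurableSet subset_rfl, ← Multiset.sum_map_mul_left]
    exact Multiset.sum_map_le_sum_map _ _ fun c _ ↦ hAc c
  calc ENNReal.ofReal (totalLength (C n))
      = ENNReal.ofReal η⁻¹ * ENNReal.ofReal (η * totalLength (C n)) := by
        rw [← ENNReal.ofReal_mul (by positivity), inv_mul_cancel_left₀ hηpos.ne']
    _ ≤ ENNReal.ofReal η⁻¹ * (A * coveringVolume F (C n) F) := mul_le_mul_right (hn.trans h1) _
    _ = ENNReal.ofReal η⁻¹ * A * coveringVolume F (C n) F := (mul_assoc _ _ _).symm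
    _ ≤ _ := by
        rw [ENNReal.ofReal_mul (by positivity)]
        gcongr
        refine (ENNReal.ofReal_toReal hA).symm.le.trans (ENNReal.ofReal_le_ofReal (by linarith))

/-! ### The time spent in a cuspidal zone -/

theorem IsScaling.conj_mem {Γ : Subgroup PSL(2, ℝ)} {a : OnePoint ℝ} {σ : PSL(2, ℝ)}
    (hσ : IsScaling Γ a σ) (k : ℤ) : σ * unipElt k * σ⁻¹ ∈ Γ := by
  have : unipElt k ∈ (fun γ ↦ σ⁻¹ * γ * σ) '' {γ | γ ∈ Γ ∧ γ • a = a} := by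
    rw [hσ.2]; exact ⟨k, rfl⟩
  obtain ⟨γ, ⟨hγ, -⟩, h⟩ := this
  simp only at h
  rw [← h]
  simpa [mul_assoc] using hγ

/-- The `Γ`-orbit of the horoball of height `t` at a cusp. -/
def horoballOrbit (Γ : Subgroup PSL(2, ℝ)) (σ : PSL(2, ℝ)) (t : ℝ) : Set ℍ :=
  {z | ∃ γ ∈ Γ, t ≤ (σ⁻¹ • γ • z).im}

/-- Moving by a distance less than `log 2` changes heights by a factor of at most `2`. -/
theorem closure_horoballOrbit_subset (Γ : Subgroup PSL(2, ℝ)) (σ : PSL(2, ℝ)) (t : ℝ) :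
    closure (horoballOrbit Γ σ t) ⊆ horoballOrbit Γ σ (t / 2) := by
  intro z hz
  obtain ⟨w, ⟨γ, hγ, hw⟩, hzw⟩ := Metric.mem_closure_iff.mp hz (Real.log 2)
    (Real.log_pos (by norm_num))
  refine ⟨γ, hγ, ?_⟩
  have h1 := UpperHalfPlane.im_le_im_mul_exp_dist (σ⁻¹ • γ • w) (σ⁻¹ • γ • z)
  rw [dist_smul, dist_smul, dist_comm] at h1
  have h2 : Real.exp (dist z w) ≤ 2 := by
    rw [← Real.exp_log (show (0 : ℝ) < 2 by norm_num)]
    exact Real.exp_le_exp.mpr hzw.le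
  have h3 := UpperHalfPlane.im_pos (σ⁻¹ • γ • z)
  nlinarith

theorem volume_inter_horoballOrbit_le {Γ : Subgroup PSL(2, ℝ)} {F : Set ℍ}
    (hF : IsFundamentalPolygon Γ F) {a : OnePoint ℝ} {σ : PSL(2, ℝ)} (hσ : IsScaling Γ a σ)
    {t : ℝ} (ht : 0 < t) : volume (F ∩ horoballOrbit Γ σ t) ≤ ENNReal.ofReal (1 / t) := by
  have hm : MeasurableSet {w : ℍ | w.re ∈ Set.Ico (0 : ℝ) 1 ∧ t ≤ w.im} :=
    (UpperHalfPlane.continuous_re.measurable measurableSet_Ico).inter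
      (isClosed_le continuous_const UpperHalfPlane.continuous_im).measurableSet
  have hvol : volume (σ • {w : ℍ | w.re ∈ Set.Ico (0 : ℝ) 1 ∧ t ≤ w.im}) =
      ENNReal.ofReal (1 / t) := by
    rw [measure_smul, volume_strip measurableSet_Ico ht]
    simp
  rw [← hvol]
  refine (measure_mono ?_).trans (hF.volume_inter_le (hm.const_smul σ))
  rintro z ⟨hz, γ, hγ, hzt⟩
  set w := σ⁻¹ • γ • z with hw
  refine ⟨hz, σ * unipElt (-⌊w.re⌋ : ℤ) * σ⁻¹ * γ, Γ.mul_mem (hσ.conj_mem _) hγ, ?_⟩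
  rw [Set.mem_smul_set_iff_inv_smul_mem]
  have h1 : σ⁻¹ • (σ * unipElt (-⌊w.re⌋ : ℤ) * σ⁻¹ * γ) • z = unipElt (-⌊w.re⌋ : ℤ) • w := by
    rw [hw]
    simp only [smul_smul, mul_assoc, inv_mul_cancel_left]
  rw [h1]
  refine ⟨?_, ?_⟩
  · rw [unipElt_smul_re]
    push_cast
    rw [← sub_eq_add_neg]
    exact ⟨Int.fract_nonneg _, Int.fract_lt_one _⟩
  · rwa [unipElt_smul_im]

/-- Equidistribution is only known for compactly supported functions, so the time in a cuspidal zone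
is bounded through a compact part of its complement that carries almost all of the area. -/
theorem eventually_sum_timeIn_zone_le {Γ : Subgroup PSL(2, ℝ)} {F : Set ℍ}
    (hF : IsFundamentalPolygon Γ F) (hfin : volume F ≠ ⊤) {C : ℕ → Multiset (ClosedGeodesic Γ)}
    (hC : Equidistributes Γ F C) {a : OnePoint ℝ} {σ : PSL(2, ℝ)} (hσ : IsScaling Γ a σ)
    {t : ℝ} (ht : 0 < t) :
    ∀ᶠ n in atTop, ((C n).map fun c ↦ c.timeIn {z | ∃ γ ∈ Γ, γ • z ∈ cuspidalZone F σ t}).sum ≤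
      ENNReal.ofReal (4 / t / volume.real F * totalLength (C n)) := by
  have hFpos : 0 < volume.real F := ENNReal.toReal_pos hF.volume_pos.ne' hfin
  set V := F \ closure (horoballOrbit Γ σ t) with hV
  have hVo : IsOpen V := hF.isOpen.sdiff isClosed_closure
  have hVF : V ⊆ F := Set.sdiff_subset
  obtain ⟨K, hKV, hK, hKlt⟩ := hVo.measurableSet.exists_isCompact_lt_add
    (ne_top_of_le_ne_top hfin (measure_mono hVF)) (ε := ENNReal.ofReal (1 / t))
    (by simpa using ht)
  have hKF : volume F ≤ volume K + ENNReal.ofReal (3 / t) := by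
    calc volume F ≤ volume V + volume (F ∩ horoballOrbit Γ σ (t / 2)) := by
          refine (measure_mono fun z hz ↦ ?_).trans (measure_union_le _ _)
          by_cases h : z ∈ closure (horoballOrbit Γ σ t)
          · exact Or.inr ⟨hz, closure_horoballOrbit_subset Γ σ t h⟩
          · exact Or.inl ⟨hz, h⟩
      _ ≤ (volume K + ENNReal.ofReal (1 / t)) + ENNReal.ofReal (1 / (t / 2)) :=
          add_le_add hKlt.le (volume_inter_horoballOrbit_le hF hσ (by positivity))
      _ = volume K + ENNReal.ofReal (3 / t) := by
          rw [add_assoc, ← ENNReal.ofReal_add (by positivity) (by positivity)]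
          congr 2
          field_simp
          norm_num
  have hKF' : volume.real F ≤ volume.real K + 3 / t := by
    have h1 := ENNReal.toReal_mono
      (ENNReal.add_ne_top.mpr ⟨hK.measure_ne_top, ENNReal.ofReal_ne_top⟩) hKF
    rwa [ENNReal.toReal_add hK.measure_ne_top ENNReal.ofReal_ne_top,
      ENNReal.toReal_ofReal (by positivity)] at h1
  set η := (volume.real F - 4 / t) / volume.real F with hη
  have hηK : η < volume.real K / volume.real F := by
    rw [hη]
    gcongr
    have : 4 / t = 3 / t + 1 / t := by ring
    have : 0 < 1 / t := by positivity
    linarith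
  have hη1 : 4 / t / volume.real F = 1 - η := by
    rw [hη]; field_simp; ring
  filter_upwards [eventually_le_sum_timeIn hF hfin hC hK hVo hKV hVF hηK] with n hn
  rw [hη1]
  have hsplit : ∀ c : ClosedGeodesic Γ, c.timeIn {z | ∃ γ ∈ Γ, γ • z ∈ cuspidalZone F σ t} +
      c.timeIn {z | ∃ γ ∈ Γ, γ • z ∈ V} ≤ ENNReal.ofReal c.length := by
    intro c
    have hdisj : Disjoint {z | ∃ γ ∈ Γ, γ • z ∈ cuspidalZone F σ t}
        {z | ∃ γ ∈ Γ, γ • z ∈ V} := by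
      refine Set.disjoint_left.mpr ?_
      rintro z ⟨γ, hγ, hz⟩ ⟨δ, hδ, -, hz'⟩
      refine hz' (subset_closure ⟨γ * δ⁻¹, Γ.mul_mem hγ (Γ.inv_mem hδ), ?_⟩)
      rw [smul_smul (γ * δ⁻¹), inv_mul_cancel_right]
      exact hz.2
    have hVm : MeasurableSet {s | s ∈ Set.Ioc 0 c.length ∧
        c.path s ∈ {z : ℍ | ∃ γ ∈ Γ, γ • z ∈ V}} :=
      measurableSet_Ioc.inter (c.measurableSet_path_mem_orbit hVo)
    rw [ClosedGeodesic.timeIn, ClosedGeodesic.timeIn, ← measure_union ?_ hVm]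
    · refine (measure_mono ?_).trans (c.timeIn_le Set.univ)
      rintro s (hs | hs) <;> exact ⟨hs.1, trivial⟩
    · exact Set.disjoint_left.mpr fun s hs hs' ↦ Set.disjoint_left.mp hdisj hs.2 hs'.2
  refine ENNReal.le_of_add_le_add_right
    (ENNReal.ofReal_ne_top (r := η * totalLength (C n))) ?_
  calc _ ≤ ((C n).map fun c ↦ c.timeIn {z | ∃ γ ∈ Γ, γ • z ∈ cuspidalZone F σ t}).sum +
        ((C n).map fun c ↦ c.timeIn {z | ∃ γ ∈ Γ, γ • z ∈ V}).sum := by gcongr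
    _ ≤ ENNReal.ofReal (totalLength (C n)) := by
        rw [← Multiset.sum_map_add, ofReal_totalLength]
        exact Multiset.sum_map_le_sum_map _ _ fun c _ ↦ hsplit c
    _ = ENNReal.ofReal ((1 - η) * totalLength (C n) + η * totalLength (C n)) := by
        congr 1; ring
    _ ≤ _ := ENNReal.ofReal_add_le

/-! ### The volume above a cuspidal zone -/

/-- The sum of `volume_halfPlane_inter_zone_le` over the crossed tiles. Only `y₀` depends on the
cusp. -/
theorem coveringArea_zone_le {Γ : Subgroup PSL(2, ℝ)} {F : Set ℍ}
    (hF : IsFundamentalPolygon Γ F) {a : OnePoint ℝ} (ha : a ∈ cuspidalVertices Γ F)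
    {σ : PSL(2, ℝ)} (hσ : IsScaling Γ a σ) :
    ∃ y₀ > 0, ∀ Y : ℝ, 1 ≤ Y → 4 * y₀ ≤ Y → ∀ c : ClosedGeodesic Γ,
      c.coveringArea F (cuspidalZone F σ Y) ≤
        ENNReal.ofReal (4 * y₀ / Y) * c.coveringArea F F +
          (ENNReal.ofReal (2 / √Y) * ENNReal.ofReal c.length +
            c.timeIn {z | ∃ γ ∈ Γ, γ • z ∈ cuspidalZone F σ √Y}) := by
  obtain ⟨I, hIo, hIc, -, y₀, hy₀, hstrip⟩ := exists_strip hF.polygon hF.nonempty hσ.1 ha.2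
  have hI1 : volume I ≤ 1 := by
    have hwidth : ∀ x ∈ I, ∀ y ∈ I, y - x ≤ 1 := by
      intro x hx y hy
      by_contra! hcon
      have hx1 : x + 1 ∈ I := hIc.out hx hy ⟨by linarith, by linarith⟩
      let z : ℍ := ⟨⟨x, y₀⟩, hy₀⟩
      have hz : σ • z ∈ F := (hstrip z le_rfl).mpr hx
      have hz1 : σ • unipElt (1 : ℤ) • z ∈ F := by
        refine (hstrip _ ?_).mpr ?_
        · rw [unipElt_smul_im]; exact le_rfl
        · rw [unipElt_smul_re, Int.cast_one]; exact hx1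
      have h1 := hF.smul_eq_self (hσ.conj_mem 1) hz
        (by rwa [mul_smul, inv_smul_smul, mul_smul])
      rw [mul_smul, inv_smul_smul, mul_smul] at h1
      have h2 := congrArg UpperHalfPlane.re (smul_left_cancel _ h1)
      rw [unipElt_smul_re] at h2
      simp at h2
    refine (Real.volume_le_diam I).trans (Metric.ediam_le fun x hx y hy ↦ ?_)
    rw [edist_dist, ENNReal.ofReal_le_one, Real.dist_eq, abs_le]
    constructor <;> linarith [hwidth x hx y hy, hwidth y hy x hx]
  refine ⟨y₀, hy₀, fun Y hY hYy c ↦ ?_⟩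
  have hzone : ∀ t : ℝ, MeasurableSet (cuspidalZone F σ t) := fun t ↦
    hF.isOpen.measurableSet.inter
      (isClosed_le continuous_const
        (UpperHalfPlane.continuous_im.comp (continuous_const_smul σ⁻¹))).measurableSet
  have htile : ∀ γ : c.crossed F,
      volume {z | (γ : PSL(2, ℝ)) • z ∈ c.leftSide ∧ z ∈ cuspidalZone F σ Y} ≤
        ENNReal.ofReal (4 * y₀ / Y) *
          volume {z | (γ : PSL(2, ℝ)) • z ∈ c.leftSide ∧ z ∈ F} +
        (ENNReal.ofReal (2 / √Y) * volume {t | c.path t ∈ (γ : PSL(2, ℝ)) • F} +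
          volume {t | c.path t ∈ (γ : PSL(2, ℝ)) • cuspidalZone F σ √Y}) := by
    intro γ
    have hflow : ∀ t, flow (σ⁻¹ * (γ : PSL(2, ℝ))⁻¹ * c.lift) t =
        σ⁻¹ • (γ : PSL(2, ℝ))⁻¹ • c.path t := fun t ↦ by
      rw [c.path_eq_flow, smul_flow, smul_flow, mul_assoc]
    have hτ : {t | flow (σ⁻¹ * (γ : PSL(2, ℝ))⁻¹ * c.lift) t ∈ {w : ℍ | σ • w ∈ F}} =
        {t | c.path t ∈ (γ : PSL(2, ℝ)) • F} := by
      ext t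
      simp only [hflow, Set.mem_ofPred_eq, smul_inv_smul, Set.mem_smul_set_iff_inv_smul_mem]
    have hside : ∀ w : ℍ, ((σ⁻¹ * (γ : PSL(2, ℝ))⁻¹ * c.lift)⁻¹ • w).re ≤ 0 ↔
        (γ : PSL(2, ℝ)) • σ • w ∈ c.leftSide := by
      intro w
      simp only [ClosedGeodesic.leftSide, Set.mem_ofPred_eq, smul_smul, mul_inv_rev, inv_inv,
        mul_assoc]
    have key := volume_halfPlane_inter_zone_le (G := {w : ℍ | σ • w ∈ F}) hIo hIc hI1 hy₀ hstrip
      (σ⁻¹ * (γ : PSL(2, ℝ))⁻¹ * c.lift)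
      (hτ ▸ ordConnected_flow_mem hF.polygon _ _) hY hYy
    rw [hτ] at key
    have hpre : ∀ E : Set ℍ, volume {w : ℍ | σ • w ∈ E} = volume E := by
      intro E
      rw [← measure_smul volume σ⁻¹ E, ← Set.preimage_smul]
      rfl
    have e1 : volume {w : ℍ | ((σ⁻¹ * (γ : PSL(2, ℝ))⁻¹ * c.lift)⁻¹ • w).re ≤ 0 ∧
        w ∈ {w : ℍ | σ • w ∈ F} ∧ Y ≤ w.im} =
        volume {z | (γ : PSL(2, ℝ)) • z ∈ c.leftSide ∧ z ∈ cuspidalZone F σ Y} := by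
      rw [← hpre {z | (γ : PSL(2, ℝ)) • z ∈ c.leftSide ∧ z ∈ cuspidalZone F σ Y}]
      simp only [hside, cuspidalZone, Set.mem_ofPred_eq, inv_smul_smul]
    have e2 : volume {w : ℍ | ((σ⁻¹ * (γ : PSL(2, ℝ))⁻¹ * c.lift)⁻¹ • w).re ≤ 0 ∧
        w ∈ {w : ℍ | σ • w ∈ F}} =
        volume {z | (γ : PSL(2, ℝ)) • z ∈ c.leftSide ∧ z ∈ F} := by
      rw [← hpre {z | (γ : PSL(2, ℝ)) • z ∈ c.leftSide ∧ z ∈ F}]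
      simp only [hside, Set.mem_ofPred_eq]
    have e3 : {t | flow (σ⁻¹ * (γ : PSL(2, ℝ))⁻¹ * c.lift) t ∈ {w : ℍ | σ • w ∈ F} ∧
        √Y ≤ (flow (σ⁻¹ * (γ : PSL(2, ℝ))⁻¹ * c.lift) t).im} =
        {t | c.path t ∈ (γ : PSL(2, ℝ)) • cuspidalZone F σ √Y} := by
      ext t
      simp only [hflow, Set.mem_ofPred_eq, smul_inv_smul, Set.mem_smul_set_iff_inv_smul_mem,
        cuspidalZone]
    rwa [e1, e2, e3] at key
  calc c.coveringArea F (cuspidalZone F σ Y)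
      ≤ _ := ENNReal.tsum_le_tsum htile
    _ = ENNReal.ofReal (4 * y₀ / Y) * c.coveringArea F F +
        (ENNReal.ofReal (2 / √Y) *
            ∑' γ : c.crossed F, volume {t | c.path t ∈ (γ : PSL(2, ℝ)) • F} +
          ∑' γ : c.crossed F, volume {t | c.path t ∈ (γ : PSL(2, ℝ)) • cuspidalZone F σ √Y}) := by
        rw [ENNReal.tsum_add, ENNReal.tsum_add, ENNReal.tsum_mul_left, ENNReal.tsum_mul_left]
        rfl
    _ ≤ _ := by
        gcongr
        · exact (c.tsum_crossed_le_timeIn hF hF.isOpen.measurableSet subset_rfl).trans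
            (c.timeIn_le _)
        · exact c.tsum_crossed_le_timeIn hF (hzone _) fun z hz ↦ hz.1

end HypSurface
end

theorem proposition4p6 (Γ : Subgroup PSL(2, ℝ)) (hdisc : DiscreteTopology Γ)
    (hcof : HypSurface.IsCofinite Γ) (F : Set ℍ) (hF : HypSurface.IsFundamentalPolygon Γ F) :
    ∃ K : ℝ, 0 < K ∧
      ∀ C : ℕ → Multiset (HypSurface.ClosedGeodesic Γ), HypSurface.Equidistributes Γ F C →
      ∀ a ∈ HypSurface.cuspidalVertices Γ F, ∀ σ : PSL(2, ℝ), HypSurface.IsScaling Γ a σ →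
      ∃ Y₀ : ℝ, 0 < Y₀ ∧ ∀ Y : ℝ, Y₀ ≤ Y → ∃ n₀ : ℕ, 1 ≤ n₀ ∧ ∀ n : ℕ, n₀ ≤ n →
        HypSurface.coveringVolume F (C n) (HypSurface.cuspidalZone F σ Y) ≤
          ENNReal.ofReal (K * Y ^ (-(1 / 2) : ℝ)) * HypSurface.coveringVolume F (C n) F := by
  have hfin := hF.volume_ne_top hcof
  have hFpos : 0 < volume.real F := ENNReal.toReal_pos hF.volume_pos.ne' hfin
  obtain ⟨A, hA, hlen⟩ := HypSurface.exists_totalLength_le hF hfin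
  refine ⟨1 + (2 + 4 / volume.real F) * A, by positivity, fun C hC a ha σ hσ ↦ ?_⟩
  obtain ⟨y₀, hy₀, harea⟩ := HypSurface.coveringArea_zone_le hF ha hσ
  -- From height `(4 y₀)²` on, `4 y₀ / Y ≤ Y ^ (-1/2)`: this removes the dependence on the cusp.
  refine ⟨1 + 4 * y₀ + (4 * y₀) ^ 2, by positivity, fun Y hY ↦ ?_⟩
  have hY1 : 1 ≤ Y := by nlinarith
  have hY4 : 4 * y₀ ≤ Y := by nlinarith
  have hY0 : 0 < Y := by linarith
  have hs0 : 0 < √Y := Real.sqrt_pos.mpr hY0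
  have hss : √Y * √Y = Y := Real.mul_self_sqrt hY0.le
  have hpow : Y ^ (-(1 / 2) : ℝ) = 1 / √Y := by
    rw [Real.rpow_neg hY0.le, ← Real.sqrt_eq_rpow, one_div]
  have hy : 4 * y₀ / Y ≤ 1 / √Y := by
    have : 4 * y₀ ≤ √Y := Real.le_sqrt_of_sq_le (by nlinarith)
    rw [div_le_div_iff₀ hY0 hs0]
    nlinarith
  obtain ⟨n₀, hn₀⟩ := eventually_atTop.mp
    ((hlen C hC).and (HypSurface.eventually_sum_timeIn_zone_le hF hfin hC hσ hs0))
  refine ⟨n₀ + 1, by omega, fun n hn ↦ ?_⟩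
  obtain ⟨h1, h2⟩ := hn₀ n (by omega)
  have hzone : MeasurableSet (HypSurface.cuspidalZone F σ Y) :=
    hF.isOpen.measurableSet.inter
      (isClosed_le continuous_const
        (UpperHalfPlane.continuous_im.comp (continuous_const_smul σ⁻¹))).measurableSet
  have hTL := HypSurface.totalLength_nonneg (C n)
  have hcov := HypSurface.coveringVolume_eq hF (C n) hF.isOpen.measurableSet subset_rfl
  rw [HypSurface.coveringVolume_eq hF (C n) hzone fun z hz ↦ hz.1]
  calc _ ≤ ((C n).map fun c ↦ ENNReal.ofReal (4 * y₀ / Y) * c.coveringArea F F +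
          (ENNReal.ofReal (2 / √Y) * ENNReal.ofReal c.length +
            c.timeIn {z | ∃ γ ∈ Γ, γ • z ∈ HypSurface.cuspidalZone F σ √Y})).sum :=
        Multiset.sum_map_le_sum_map _ _ fun c _ ↦ harea Y hY1 hY4 c
    _ = ENNReal.ofReal (4 * y₀ / Y) * HypSurface.coveringVolume F (C n) F +
          (ENNReal.ofReal (2 / √Y) * ENNReal.ofReal (HypSurface.totalLength (C n)) +
          ((C n).map fun c ↦
            c.timeIn {z | ∃ γ ∈ Γ, γ • z ∈ HypSurface.cuspidalZone F σ √Y}).sum) := by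
        rw [Multiset.sum_map_add, Multiset.sum_map_add, Multiset.sum_map_mul_left,
          Multiset.sum_map_mul_left, ← hcov, HypSurface.ofReal_totalLength]
    _ ≤ ENNReal.ofReal (1 / √Y) * HypSurface.coveringVolume F (C n) F +
          (ENNReal.ofReal (2 / √Y) * ENNReal.ofReal (HypSurface.totalLength (C n)) +
          ENNReal.ofReal (4 / √Y / volume.real F) *
            ENNReal.ofReal (HypSurface.totalLength (C n))) := by
        rw [← ENNReal.ofReal_mul (p := 4 / √Y / volume.real F) (by positivity)]
        gcongr
    _ = ENNReal.ofReal (1 / √Y) * HypSurface.coveringVolume F (C n) F +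
          ENNReal.ofReal (2 / √Y + 4 / √Y / volume.real F) *
            ENNReal.ofReal (HypSurface.totalLength (C n)) := by
        rw [← add_mul, ENNReal.ofReal_add (by positivity) (by positivity)]
    _ ≤ ENNReal.ofReal (1 / √Y) * HypSurface.coveringVolume F (C n) F +
          ENNReal.ofReal (2 / √Y + 4 / √Y / volume.real F) *
            (ENNReal.ofReal A * HypSurface.coveringVolume F (C n) F) := by
        gcongr
    _ = _ := by
        rw [← mul_assoc, ← ENNReal.ofReal_mul (by positivity), ← add_mul,
          ← ENNReal.ofReal_add (by positivity) (by positivity), hpow]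
        congr 2
        field_simp
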